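/- Let $n\ge 1$. Given $\alpha_0,\dots,\alpha_{n-2}$ in the open unit disk and $\alpha_{n-1}$ on the unit circle, put $\rho_j=\sqrt{1-|\alpha_j|^2}$, $\Xi_j=\begin{bmatrix}\bar\alpha_j&\rho_j\\ \rho_j&-\alpha_j\end{bmatrix}$ for $0\le j\le n-2$, and let $\Xi_{-1}=[1]$, $\Xi_{n-1}=[\bar\alpha_{n-1}]$ be $1\times1$ matrices. The CMV matrix with Verblunsky coefficients $\alpha_0,\dots,\alpha_{n-1}$ is the $n\times n$ matrix $\mathcal C=\mathcal L\mathcal M$, where $\mathcal L=\operatorname{diag}(\Xi_0,\Xi_2,\dots)$ and $\mathcal M=\operatorname{diag}(\Xi_{-1},\Xi_1,\Xi_3,\dots)$. On the real vector space of complex $n\times n$ matrices, let $\langle X,Y\rangle=\operatorname{Im}\operatorname{tr}(XY)$, let $\nabla\phi$ be the gradient with respect to this pairing, let $R(L+A)=L-A$ for $L$ lower triangular with real diagonal and $A$ anti-Hermitian, and let the Poisson bracket be $$\{\phi,\psi\}(B)=\tfrac12\langle R(XB),YB\rangle-\tfrac12\langle R(BX),BY\rangle,\qquad X=\nabla\phi|_B,\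 Y=\nabla\psi|_B .$$ Let $f$ be a complex polynomial and $F(z)=2\operatorname{Re}[zf'(z)]$. Let $\mathcal C(t)$, $t\ge0$, be a trajectory of the flow generated by $\phi(B)=\operatorname{Im}\operatorname{tr}f(B)$ (that is, $\frac{d}{dt}\psi(\mathcal C(t))=\{\phi,\psi\}(\mathcal C(t))$ for all smooth real functions $\psi$) such that $\mathcal C(0)$ is a CMV matrix. Let $z_1,\dots,z_n$ be the eigenvalues of $\mathcal C(0)$, labelled so that $\lambda_j:=F(z_j)$ satisfies $\lambda_1\ge\lambda_2\ge\dots\ge\lambda_n$, and let $\mu_j$ be the mass that the spectral measure of $\mathcal C(0)$ and the vector $e_1=[1,0,\dots,0]^T$ gives to $z_j$. For a finite set $I$ of indices write $\mu_I=\prod_{i\in I}\mu_i$, $z_I=\prod_{i\in I}z_i$ and $\Delta_I=\prod_{i<j,\ i,j\in I}(z_j-z_i)$. Then $\mathcal C(t)$ is a CMV matrix for every $t\ge0$, and its Verblunsky coefficients $\alpha_0(t),\dots,\alpha_{n-1}(t)$ have the following properties for each $1\le k\le n-1$. Let $B_k=\{l:\lambda_l=\lambda_k\}$, $J=\{l:\lambda_l>\lambda_k\}$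 and $s(k)=|J|$, so that $J=\{1,\dots,s(k)\}$. (1) As $t\to\infty$, $$\alpha_{k-1}(t)\to(-1)^{k-1}\,\bar z_J\,\frac{\sum_I|\Delta_{J\cup I}|^2\mu_I\bar z_I}{\sum_I|\Delta_{J\cup I}|^2\mu_I},$$ where both sums run over all $I\subseteq B_k$ with $k-s(k)$ elements. (2) $|\alpha_{k-1}(t)|\to1$ if and only if $\lambda_k>\lambda_{k+1}$. (3) If all $\lambda_j$ are distinct, then $\lambda_k-\lambda_{k+1}>0$ and there is $\gamma>\lambda_k-\lambda_{k+1}$ such that, as $t\to\infty$, $$\alpha_{k-1}(t)=(-1)^{k-1}\bar z_1\cdots\bar z_k\Bigl[1+\xi_{k-1}e^{-(\lambda_k-\lambda_{k+1})t}+O(e^{-\gamma t})\Bigr],\qquad \xi_{k-1}=(z_k\bar z_{k+1}-1)\frac{\mu_{k+1}}{\mu_k}\prod_{l=1}^{k-1}\left|\frac{z_{k+1}-z_l}{z_k-z_l}\right|^2 .$$ -/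

import Mathlib

open Filter Topology Asymptotics
open scoped ContDiff Matrix ComplexConjugate

noncomputable section

namespace CMVFlow

/-! ### CMV matrices -/

/-- Admissible Verblunsky coefficients `α_0, …, α_{n-1}`: all of them in the open unit disk,
except for the last one, which lies on the unit circle. -/
def IsVerblunsky {n : ℕ} (α : Fin n → ℂ) : Prop :=
  ∀ j : Fin n, if j.val + 1 < n then ‖α j‖ < 1 else ‖α j‖ = 1

/-- `ρ = √(1 - |α|²)`. -/
def rho (a : ℂ) : ℝ := Real.sqrt (1 - ‖a‖ ^ 2)

/-- The `n × n` block-diagonal matrix (indices start at `0`) that is built from the blocks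
`Ξ_m = [[conj α_m, ρ_m], [ρ_m, -α_m]]` in the rows and columns `m, m + 1`, for all `m` of the
same parity as `p`; for `m = n - 1` only the corner `[conj α_{n-1}]` of the block is there, and
if row `0` is not covered (that is, `p` is odd), it carries the block `Ξ_{-1} = [1]`. -/
def blockFactor (p : ℕ) {n : ℕ} (α : Fin n → ℂ) : Matrix (Fin n) (Fin n) ℂ :=
  Matrix.of fun i j =>
    if i = j then
      if i.val % 2 = p % 2 then conj (α i)
      else if i.val = 0 then 1
      else -α ⟨i.val - 1, by omega⟩
    else if i.val + 1 = j.val ∧ i.val % 2 = p % 2 then (rho (α i) : ℂ)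
    else if j.val + 1 = i.val ∧ j.val % 2 = p % 2 then (rho (α j) : ℂ)
    else 0

/-- The CMV matrix `C = L M` with `L = diag(Ξ_0, Ξ_2, Ξ_4, …)` and
`M = diag(Ξ_{-1}, Ξ_1, Ξ_3, …)`. -/
def cmv {n : ℕ} (α : Fin n → ℂ) : Matrix (Fin n) (Fin n) ℂ :=
  blockFactor 0 α * blockFactor 1 α

/-! ### The quadratic (Gelfand-Dikij) Poisson bracket on complex matrices -/

/-- The pairing `⟨X, Y⟩ = Im tr (X Y)`. -/
def pairing {n : ℕ} (X Y : Matrix (Fin n) (Fin n) ℂ) : ℝ := (X * Y).trace.im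

/-- The projection onto the anti-Hermitian matrices, along the lower triangular matrices with
real diagonal. -/
def projA {n : ℕ} (X : Matrix (Fin n) (Fin n) ℂ) : Matrix (Fin n) (Fin n) ℂ :=
  Matrix.of fun i j =>
    if i < j then X i j
    else if j < i then -conj (X j i)
    else Complex.I * ((X i i).im : ℂ)

/-- The projection onto the lower triangular matrices with real diagonal, along the
anti-Hermitian matrices. -/
def projL {n : ℕ} (X : Matrix (Fin n) (Fin n) ℂ) : Matrix (Fin n) (Fin n) ℂ := X - projA X

theorem projA_conjTranspose {n : ℕ} (X : Matrix (Fin n) (Fin n) ℂ) :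
    (projA X)ᴴ = -projA X := by
  ext i j
  rcases lt_trichotomy i j with h | h | h
  · simp [projA, h, h.not_gt]
  · subst h
    simp [projA]
  · simp [projA, h, h.not_gt]

theorem projL_upper {n : ℕ} (X : Matrix (Fin n) (Fin n) ℂ) {i j : Fin n} (h : i < j) :
    projL X i j = 0 := by
  simp [projL, projA, h]

theorem projL_diag {n : ℕ} (X : Matrix (Fin n) (Fin n) ℂ) (i : Fin n) :
    (projL X i i).im = 0 := by
  simp [projL, projA]

/-- `R(L + A) = L - A` for `L` lower triangular with real diagonal and `A` anti-Hermitian. -/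
def rMatrix {n : ℕ} (X : Matrix (Fin n) (Fin n) ℂ) : Matrix (Fin n) (Fin n) ℂ :=
  projL X - projA X

/-- The gradient `∇φ` at `B`, with respect to the pairing: the `(k, l)` entry is
`∂φ/∂v_{l,k} + i ∂φ/∂u_{l,k}`, where the matrix entries are `b_{k,l} = u_{k,l} + i v_{k,l}`. -/
def grad {n : ℕ} (φ : Matrix (Fin n) (Fin n) ℂ → ℝ) (B : Matrix (Fin n) (Fin n) ℂ) :
    Matrix (Fin n) (Fin n) ℂ :=
  Matrix.of fun k l =>
    ((lineDeriv ℝ φ B (Matrix.single l k Complex.I) : ℝ) : ℂ)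
      + Complex.I * ((lineDeriv ℝ φ B (Matrix.single l k 1) : ℝ) : ℂ)

/-- The Poisson bracket `{φ, ψ}` at `B`: with `X = ∇φ` and `Y = ∇ψ`, it is
`½ ⟨R(X B), Y B⟩ - ½ ⟨R(B X), B Y⟩`. -/
def bracket {n : ℕ} (φ ψ : Matrix (Fin n) (Fin n) ℂ → ℝ) (B : Matrix (Fin n) (Fin n) ℂ) : ℝ :=
  (1 / 2) * pairing (rMatrix (grad φ B * B)) (grad ψ B * B)
    - (1 / 2) * pairing (rMatrix (B * grad φ B)) (B * grad ψ B)

section Flow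

attribute [local instance] Matrix.normedAddCommGroup Matrix.normedSpace

/-- `C(t)`, `t ≥ 0`, moves under the flow generated by the Hamiltonian `φ`: along `C`, every
smooth function `ψ` satisfies `dψ/dt = {φ, ψ}`. -/
def IsTrajectory {n : ℕ} (φ : Matrix (Fin n) (Fin n) ℂ → ℝ)
    (C : ℝ → Matrix (Fin n) (Fin n) ℂ) : Prop :=
  ∀ ψ : Matrix (Fin n) (Fin n) ℂ → ℝ, ContDiff ℝ ∞ ψ → ∀ t : ℝ, 0 ≤ t →
    HasDerivWithinAt (fun s => ψ (C s)) (bracket φ ψ (C t)) (Set.Ici 0) t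

end Flow

/-- The Hamiltonian `φ(B) = Im tr f(B)` of a polynomial `f`. -/
def hamiltonian {n : ℕ} (f : Polynomial ℂ) (B : Matrix (Fin n) (Fin n) ℂ) : ℝ :=
  (Polynomial.aeval B f).trace.im

/-- `F(z) = 2 Re (z f'(z))`. -/
def rate (f : Polynomial ℂ) (z : ℂ) : ℝ := 2 * (z * f.derivative.eval z).re

/-! ### Spectral data and the asymptotic quantities -/

/-- The mass that the spectral measure of the (normal) matrix `C` and the vector `e_1` gives to
the point `w`: the squared norm of the orthogonal projection of `e_1` onto the eigenspace
`ker (C - w)`. -/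
def spectralMass {n : ℕ} [NeZero n] (C : Matrix (Fin n) (Fin n) ℂ) (w : ℂ) : ℝ :=
  ‖(Module.End.eigenspace (Matrix.toEuclideanLin C) w).starProjection
    (EuclideanSpace.single (0 : Fin n) (1 : ℂ))‖ ^ 2

/-- `μ_I`, `z_I`: products over a multi-index. -/
def multi {n : ℕ} {M : Type} [CommMonoid M] (x : Fin n → M) (I : Finset (Fin n)) : M :=
  ∏ i ∈ I, x i

/-- The Vandermonde determinant `Δ_I` of the points `z_i`, `i ∈ I`, in increasing order. -/
def vander {n : ℕ} (z : Fin n → ℂ) (I : Finset (Fin n)) : ℂ :=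
  ∏ p ∈ (I ×ˢ I).filter (fun p => p.1 < p.2), (z p.2 - z p.1)

/-- `B_a`: the indices whose `λ` is tied with `λ_a`. -/
def tied {n : ℕ} (lam : Fin n → ℝ) (a : Fin n) : Finset (Fin n) :=
  Finset.univ.filter fun l => lam l = lam a

/-- `J`: the indices with a strictly larger `λ` than `λ_a`. If `λ` is non-increasing, these are
the indices before `B_a`. -/
def above {n : ℕ} (lam : Fin n → ℝ) (a : Fin n) : Finset (Fin n) :=
  Finset.univ.filter fun l => lam a < lam l

/-- The sets `I ⊆ B_a` with `k - s` elements, where `k = a + 1` (the indices start at `0`) and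
`s` is the number of elements of `J`. -/
def choices {n : ℕ} (lam : Fin n → ℝ) (a : Fin n) : Finset (Finset (Fin n)) :=
  (tied lam a).powersetCard (a.val + 1 - (above lam a).card)

/-- `(-1)^{k-1} conj z_J (∑ |Δ_{J ∪ I}|² μ_I conj z_I) / (∑ |Δ_{J ∪ I}|² μ_I)`, where
`k - 1 = a` and the sums run over all `I ⊆ B_a` with `|J| + |I| = k`. -/
def limitValue {n : ℕ} (lam : Fin n → ℝ) (z : Fin n → ℂ) (μ : Fin n → ℝ) (a : Fin n) : ℂ :=
  (-1) ^ a.val * conj (multi z (above lam a)) *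
    ((∑ I ∈ choices lam a,
        ((‖vander z (above lam a ∪ I)‖ ^ 2 * multi μ I : ℝ) : ℂ) * conj (multi z I)) /
      ((∑ I ∈ choices lam a, ‖vander z (above lam a ∪ I)‖ ^ 2 * multi μ I : ℝ) : ℂ))

/-- `ξ = (z_a conj z_b - 1) (μ_b / μ_a) ∏_{l < a} |(z_b - z_l) / (z_a - z_l)|²`, used for
consecutive indices `a` and `b`. -/
def xi {n : ℕ} (z : Fin n → ℂ) (μ : Fin n → ℝ) (a b : Fin n) : ℂ :=
  (z a * conj (z b) - 1) * ((μ b / μ a : ℝ) : ℂ) *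
    ((∏ l ∈ Finset.Iio a, ‖(z b - z l) / (z a - z l)‖ ^ 2 : ℝ) : ℂ)

end CMVFlow

end

open CMVFlow

/-! Put `G(B) = B f'(B)`. The Hamiltonian equation is a Lax equation
`C' = [projA (G(C)), C] = -[projL (G(C)), C]`, so the lower triangular solution `W` of
`W' = -projL (G(C)) W`, `W(0) = 1`, intertwines `C(0)` and `C(t)`, while `W Q exp(t G(z))` stays
unitary for a unitary eigenvector matrix `Q` of `C(0)`. A unitary matrix with the zero pattern and
the positive corners of a CMV matrix is a CMV matrix, and conjugation by triangular matrices with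
positive diagonal keeps both, so `C(t)` is a CMV matrix.

A Verblunsky coefficient is, up to sign and conjugation, a leading minor of the CMV matrix. The rows
of `Q` are triangular combinations of its first row multiplied by `1, conj z, z, conj z², z², …`, so
by the Cauchy-Binet formula `α_{k-1}(t)` is `(-1)^{k-1}` times the average of `conj z_I` over the
multi-indices `I` with `k` elements, with the weights `|Δ_I|² μ_I exp(t ∑_{i ∈ I} λ_i)`. The largest
exponents give the limit, strict convexity of the disk decides when it is unimodular, and the two
largest exponents give the first-order expansion. -/

noncomputable section

namespace CMVFlow

open scoped ComplexOrder

/-! ### The Cauchy-Binet formula -/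

section CauchyBinet

variable {k : ℕ} {m R : Type*} [CommRing R]

theorem det_mul_eq_sum_det_submatrix_mul_prod [Fintype m] (A : Matrix (Fin k) m R)
    (B : Matrix m (Fin k) R) :
    (A * B).det = ∑ f : Fin k → m, (A.submatrix id f).det * ∏ i, B (f i) i := by
  simp only [Matrix.det_apply', Matrix.mul_apply, Finset.prod_univ_sum, Finset.mul_sum,
    Fintype.piFinset_univ, Matrix.submatrix_apply, id, Finset.sum_mul]
  rw [Finset.sum_comm]
  refine Finset.sum_congr rfl fun f _ => Finset.sum_congr rfl fun σ _ => ?_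
  rw [Finset.prod_mul_distrib]
  ring

theorem sum_perm_det_submatrix_mul_prod (A : Matrix (Fin k) m R) (B : Matrix m (Fin k) R)
    (e : Fin k → m) :
    ∑ σ : Equiv.Perm (Fin k), (A.submatrix id (e ∘ σ)).det * ∏ i, B (e (σ i)) i =
      (A.submatrix id e).det * (B.submatrix e id).det := by
  rw [Matrix.det_apply' (B.submatrix e id), Finset.mul_sum]
  refine Finset.sum_congr rfl fun σ _ => ?_
  have hperm := Matrix.det_permute' σ (A.submatrix id e)
  rw [Matrix.submatrix_submatrix, Function.id_comp] at hperm
  rw [hperm]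
  simp only [Matrix.submatrix_apply, id]
  ring

variable [LinearOrder m]

theorem exists_eq_orderEmbedding_comp_perm_of_injective {f : Fin k → m}
    (hf : Function.Injective f) : ∃ (e : Fin k ↪o m) (σ : Equiv.Perm (Fin k)), f = e ∘ σ := by
  have hmono : StrictMono (f ∘ Tuple.sort f) :=
    (Tuple.monotone_sort f).strictMono_of_injective (hf.comp (Tuple.sort f).injective)
  refine ⟨OrderEmbedding.ofStrictMono _ hmono, (Tuple.sort f)⁻¹, funext fun i => ?_⟩
  simp [Function.comp_apply]

theorem orderEmbedding_comp_perm_injective :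
    Function.Injective fun p : (Fin k ↪o m) × Equiv.Perm (Fin k) => (p.1 ∘ p.2 : Fin k → m) := by
  rintro ⟨e, σ⟩ ⟨e', σ'⟩ (h : e ∘ σ = e' ∘ σ')
  have hrange : Set.range e = Set.range e' := by
    simpa [Set.range_comp] using congrArg Set.range h
  obtain rfl : e = e' :=
    DFunLike.coe_injective ((e.strictMono.range_inj e'.strictMono).1 hrange)
  exact congrArg (Prod.mk e) (Equiv.ext fun i => e.injective (congrFun h i))

theorem det_mul_eq_sum_orderEmbedding [Fintype m] (A : Matrix (Fin k) m R)
    (B : Matrix m (Fin k) R) :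
    (A * B).det = ∑ e : Fin k ↪o m, (A.submatrix id e).det * (B.submatrix e id).det := by
  have hzero : ∀ f : Fin k → m,
      (f ∉ Set.range fun p : (Fin k ↪o m) × Equiv.Perm (Fin k) => (p.1 ∘ p.2 : Fin k → m)) →
        (A.submatrix id f).det * ∏ i, B (f i) i = 0 := by
    intro f hf
    obtain ⟨i, j, hij, hne⟩ : ∃ i j, f i = f j ∧ i ≠ j := by
      by_contra! hinj
      obtain ⟨e, σ, rfl⟩ := exists_eq_orderEmbedding_comp_perm_of_injective fun i j => hinj i j
      exact hf ⟨(e, σ), rfl⟩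
    rw [Matrix.det_zero_of_column_eq hne fun l => by simp only [Matrix.submatrix_apply, hij],
      zero_mul]
  rw [det_mul_eq_sum_det_submatrix_mul_prod,
    ← Fintype.sum_of_injective _ orderEmbedding_comp_perm_injective _ _ hzero fun _ => rfl,
    Fintype.sum_prod_type]
  exact Finset.sum_congr rfl fun e _ => sum_perm_det_submatrix_mul_prod A B e

end CauchyBinet

/-! ### Diagonalization of unitary matrices -/

section Diagonalization

theorem exists_perm_comp_eq_of_map_univ_eq {ι α : Type*} [Fintype ι] {d z : ι → α}
    (h : Multiset.map d Finset.univ.val = Multiset.map z Finset.univ.val) :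
    ∃ σ : Equiv.Perm ι, ∀ i, d (σ i) = z i := by
  classical
  have hcard : ∀ w, Fintype.card {i // z i = w} = Fintype.card {i // d i = w} := by
    intro w
    have hcount := congrArg (Multiset.count w) h
    rw [Multiset.count_map, Multiset.count_map] at hcount
    rw [Fintype.card_subtype, Fintype.card_subtype]
    simpa only [Finset.card_def, Finset.filter_val, eq_comm (b := w)] using hcount.symm
  exact ⟨Equiv.ofFiberEquiv (f := z) (g := d) fun w => Fintype.equivOfCardEq (hcard w),
    Equiv.ofFiberEquiv_map _⟩

theorem exists_perm_comp_eq_of_prod_X_sub_C_eq {ι R : Type*} [Fintype ι] [CommRing R] [IsDomain R]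
    {d z : ι → R}
    (h : ∏ j, (Polynomial.X - Polynomial.C (d j)) = ∏ j, (Polynomial.X - Polynomial.C (z j))) :
    ∃ σ : Equiv.Perm ι, ∀ i, d (σ i) = z i := by
  have hroots : ∀ y : ι → R, (∏ j, (Polynomial.X - Polynomial.C (y j))).roots
      = Multiset.map y Finset.univ.val := by
    intro y
    rw [← Polynomial.roots_multiset_prod_X_sub_C (Multiset.map y Finset.univ.val),
      Multiset.map_map]
    rfl
  exact exists_perm_comp_eq_of_map_univ_eq (by rw [← hroots, ← hroots, h])

section LinearIsometry

variable {𝕜 E : Type*} [RCLike 𝕜] [NormedAddCommGroup E] [InnerProductSpace 𝕜 E]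

theorem isSemisimple_linearIsometry [FiniteDimensional 𝕜 E] (T : E →ₗᵢ[𝕜] E) :
    Module.End.IsSemisimple T.toLinearMap := by
  rw [Module.End.isSemisimple_iff]
  intro p hp
  refine ⟨pᗮ, fun v hv w hw => ?_, Submodule.isCompl_orthogonal p⟩
  have hsurj : Function.Surjective (T.toLinearMap.restrict (p := p) (q := p) fun x hx => hp hx) :=
    LinearMap.injective_iff_surjective.1 fun x y hxy =>
      Subtype.ext (T.injective (congrArg Subtype.val hxy))
  obtain ⟨⟨u, hu⟩, huw⟩ := hsurj ⟨w, hw⟩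
  obtain rfl : T u = w := congrArg Subtype.val huw
  exact (T.inner_map_map u v).trans (hv u hu)

theorem orthogonalFamily_eigenspace_linearIsometry (T : E →ₗᵢ[𝕜] E) :
    OrthogonalFamily 𝕜 (fun c => Module.End.eigenspace T.toLinearMap c)
      fun c => (Module.End.eigenspace T.toLinearMap c).subtypeₗᵢ := by
  rintro c d hcd ⟨v, hv⟩ ⟨w, hw⟩
  replace hv : T v = c • v := Module.End.mem_eigenspace_iff.1 hv
  replace hw : T w = d • w := Module.End.mem_eigenspace_iff.1 hw
  change inner 𝕜 v w = 0
  by_contra hvw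
  have hvv : inner 𝕜 v v ≠ 0 := inner_self_ne_zero.2 fun h => hvw (by rw [h, inner_zero_left])
  have hcc : conj c * c = 1 := by
    refine mul_right_cancel₀ hvv ?_
    rw [one_mul, mul_assoc, ← inner_smul_right, ← inner_smul_left, ← hv, T.inner_map_map]
  have hdd : conj c * d = 1 := by
    refine mul_right_cancel₀ hvw ?_
    rw [one_mul, mul_assoc, ← inner_smul_right, ← inner_smul_left, ← hv, ← hw, T.inner_map_map]
  exact hcd (mul_left_cancel₀ (left_ne_zero_of_mul_eq_one hcc) (hcc.trans hdd.symm))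

end LinearIsometry

theorem exists_orthonormalBasis_eigenvectors {E : Type*} [NormedAddCommGroup E]
    [InnerProductSpace ℂ E] [FiniteDimensional ℂ E] {n : ℕ} (hn : Module.finrank ℂ E = n)
    (T : E →ₗᵢ[ℂ] E) :
    ∃ (b : OrthonormalBasis (Fin n) ℂ E) (d : Fin n → ℂ), ∀ i, T (b i) = d i • b i := by
  have hfam : OrthogonalFamily ℂ
      (fun c : Module.End.Eigenvalues T.toLinearMap =>
        Module.End.eigenspace T.toLinearMap (c : ℂ))
      fun c => (Module.End.eigenspace T.toLinearMap (c : ℂ)).subtypeₗᵢ :=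
    (orthogonalFamily_eigenspace_linearIsometry T).comp Subtype.coe_injective
  classical
  have hint : DirectSum.IsInternal
      (fun c : Module.End.Eigenvalues T.toLinearMap =>
        Module.End.eigenspace T.toLinearMap (c : ℂ)) := by
    rw [hfam.isInternal_iff, Submodule.orthogonal_eq_bot_iff, eq_top_iff,
      ← (isSemisimple_linearIsometry T).iSup_eigenspace_eq_top]
    refine iSup_le fun c => ?_
    by_cases hc : Module.End.HasEigenvalue T.toLinearMap c
    · exact le_iSup (fun c : Module.End.Eigenvalues T.toLinearMap =>
        Module.End.eigenspace T.toLinearMap (c : ℂ)) ⟨c, hc⟩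
    · rw [Module.End.hasEigenvalue_iff, not_not] at hc
      exact hc ▸ bot_le
  exact ⟨hint.subordinateOrthonormalBasis hn hfam,
    fun i => (hint.subordinateOrthonormalBasisIndex hn i hfam : Module.End.Eigenvalues _),
    fun i => Module.End.mem_eigenspace_iff.1
      (hint.subordinateOrthonormalBasis_subordinate hn i hfam)⟩

variable {n : ℕ} {C : Matrix (Fin n) (Fin n) ℂ}

/-- The isometry of `ℂⁿ` that a unitary matrix represents. -/
def toEuclideanIsometry (hC : C ∈ Matrix.unitaryGroup (Fin n) ℂ) :
    EuclideanSpace ℂ (Fin n) →ₗᵢ[ℂ] EuclideanSpace ℂ (Fin n) :=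
  (Matrix.toEuclideanLin C).isometryOfInner fun v w => by
    have hCC : Cᴴ * C = 1 := hC.1
    simp only [EuclideanSpace.inner_eq_star_dotProduct, Matrix.toLpLin_apply]
    rw [Matrix.star_mulVec, dotProduct_comm, ← Matrix.dotProduct_mulVec, Matrix.mulVec_mulVec, hCC,
      Matrix.one_mulVec, dotProduct_comm]

theorem exists_unitary_mul_eq_mul_diagonal_of_orthonormalBasis
    (b : OrthonormalBasis (Fin n) ℂ (EuclideanSpace ℂ (Fin n))) {d : Fin n → ℂ}
    (hb : ∀ i, Matrix.toEuclideanLin C (b i) = d i • b i) :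
    ∃ Q ∈ Matrix.unitaryGroup (Fin n) ℂ, C * Q = Q * Matrix.diagonal d := by
  refine ⟨(EuclideanSpace.basisFun (Fin n) ℂ).toBasis.toMatrix b,
    OrthonormalBasis.toMatrix_orthonormalBasis_mem_unitary _ _, ?_⟩
  ext i j
  have hbij := congrArg (fun v : EuclideanSpace ℂ (Fin n) => v i) (hb j)
  simp only [Matrix.toLpLin_apply, PiLp.smul_apply, smul_eq_mul] at hbij
  rw [Matrix.mul_diagonal, mul_comm]
  exact hbij

theorem charpoly_eq_of_mul_eq_mul_diagonal {Q : Matrix (Fin n) (Fin n) ℂ} {d : Fin n → ℂ}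
    (hQ : Q ∈ Matrix.unitaryGroup (Fin n) ℂ) (hCQ : C * Q = Q * Matrix.diagonal d) :
    C.charpoly = ∏ j, (Polynomial.X - Polynomial.C (d j)) := by
  have hC : C = Q * (Matrix.diagonal d * star Q) := by
    rw [← mul_assoc, ← hCQ, mul_assoc, hQ.2, mul_one]
  rw [← Matrix.charpoly_diagonal, hC, Matrix.charpoly_mul_comm, mul_assoc, hQ.1, mul_one]

theorem exists_unitary_mul_eq_mul_diagonal (hC : C ∈ Matrix.unitaryGroup (Fin n) ℂ) {z : Fin n → ℂ}
    (hz : C.charpoly = ∏ j, (Polynomial.X - Polynomial.C (z j))) :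
    ∃ Q ∈ Matrix.unitaryGroup (Fin n) ℂ, C * Q = Q * Matrix.diagonal z := by
  obtain ⟨b, d, hb⟩ := exists_orthonormalBasis_eigenvectors finrank_euclideanSpace_fin
    (toEuclideanIsometry hC)
  obtain ⟨Q, hQ, hCQ⟩ := exists_unitary_mul_eq_mul_diagonal_of_orthonormalBasis b hb
  obtain ⟨σ, hσ⟩ := exists_perm_comp_eq_of_prod_X_sub_C_eq
    ((charpoly_eq_of_mul_eq_mul_diagonal hQ hCQ).symm.trans hz)
  refine exists_unitary_mul_eq_mul_diagonal_of_orthonormalBasis (b.reindex σ.symm) fun i => ?_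
  rw [OrthonormalBasis.reindex_apply, Equiv.symm_symm, ← hσ]
  exact hb (σ i)

end Diagonalization

/-! ### The recursive structure of CMV matrices -/

section OneBlock

variable {n : ℕ} {R : Type*} [CommRing R]

/-- The block matrix `diag(1, N)`, with the rows and columns of `N` shifted by one. -/
def oneBlock (N : Matrix (Fin n) (Fin n) R) : Matrix (Fin (n + 1)) (Fin (n + 1)) R :=
  Matrix.of fun i j =>
    Fin.cases (Fin.cases 1 (fun _ => 0) j) (fun i' => Fin.cases 0 (fun j' => N i' j') j) i

variable (N P : Matrix (Fin n) (Fin n) R)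

@[simp] theorem oneBlock_zero_zero : oneBlock N 0 0 = 1 := rfl

@[simp] theorem oneBlock_zero_succ (j : Fin n) : oneBlock N 0 j.succ = 0 := rfl

@[simp] theorem oneBlock_succ_zero (i : Fin n) : oneBlock N i.succ 0 = 0 := rfl

@[simp] theorem oneBlock_succ_succ (i j : Fin n) : oneBlock N i.succ j.succ = N i j := rfl

@[simp] theorem oneBlock_one_zero (N : Matrix (Fin (n + 1)) (Fin (n + 1)) R) :
    oneBlock N 1 0 = 0 := rfl

@[simp] theorem oneBlock_zero_one (N : Matrix (Fin (n + 1)) (Fin (n + 1)) R) :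
    oneBlock N 0 1 = 0 := rfl

theorem oneBlock_mul : oneBlock (N * P) = oneBlock N * oneBlock P := by
  ext i j
  cases i using Fin.cases <;> cases j using Fin.cases <;>
    simp [Matrix.mul_apply, Fin.sum_univ_succ]

theorem oneBlock_conjTranspose [StarRing R] : (oneBlock N)ᴴ = oneBlock Nᴴ := by
  ext i j
  cases i using Fin.cases <;> cases j using Fin.cases <;> simp

theorem oneBlock_one : oneBlock (1 : Matrix (Fin n) (Fin n) R) = 1 := by
  ext i j
  cases i using Fin.cases <;> cases j using Fin.cases <;>
    simp [Matrix.one_apply, (Fin.succ_ne_zero _).symm]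

theorem oneBlock_injective : Function.Injective (oneBlock (n := n) (R := R)) := fun N P h => by
  ext i j
  rw [← oneBlock_succ_succ N, h, oneBlock_succ_succ]

theorem det_oneBlock : (oneBlock N).det = N.det := by
  rw [Matrix.det_succ_row_zero, Fin.sum_univ_succ]
  simp only [oneBlock_zero_zero, oneBlock_zero_succ, mul_zero, zero_mul, Finset.sum_const_zero,
    Fin.val_zero, pow_zero, one_mul, add_zero]
  rfl

theorem oneBlock_mem_unitaryGroup_iff [StarRing R] {N : Matrix (Fin n) (Fin n) R} :
    oneBlock N ∈ Matrix.unitaryGroup (Fin (n + 1)) R ↔ N ∈ Matrix.unitaryGroup (Fin n) R := by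
  rw [Matrix.mem_unitaryGroup_iff, Matrix.mem_unitaryGroup_iff, Matrix.star_eq_conjTranspose,
    Matrix.star_eq_conjTranspose, oneBlock_conjTranspose, ← oneBlock_mul, ← oneBlock_one,
    oneBlock_injective.eq_iff]

end OneBlock

theorem rho_mul_self {a : ℂ} (ha : ‖a‖ ≤ 1) : (rho a : ℂ) * rho a = 1 - conj a * a := by
  rw [← Complex.normSq_eq_conj_mul_self, Complex.normSq_eq_norm_sq, ← Complex.ofReal_mul, rho,
    Real.mul_self_sqrt (by nlinarith [norm_nonneg a])]
  push_cast
  rfl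

theorem rho_pos {a : ℂ} (ha : ‖a‖ < 1) : 0 < rho a :=
  Real.sqrt_pos.2 (by nlinarith [norm_nonneg a])

theorem rho_conj (a : ℂ) : rho (conj a) = rho a := by
  rw [rho, rho, RCLike.norm_conj]

/-- The block matrix `diag(Ξ, 1)` with `Ξ = [[conj a, ρ], [ρ, -a]]`, the first factor that is
split off a CMV matrix. -/
def xiBlock (n : ℕ) (a : ℂ) : Matrix (Fin (n + 2)) (Fin (n + 2)) ℂ :=
  Matrix.of fun i j =>
    if i = 0 then if j = 0 then conj a else if j = 1 then (rho a : ℂ) else 0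
    else if i = 1 then if j = 0 then (rho a : ℂ) else if j = 1 then -a else 0
    else if i = j then 1 else 0

section XiBlock

variable {n : ℕ} (a : ℂ) (X : Matrix (Fin (n + 2)) (Fin (n + 2)) ℂ)

theorem succ_succ_ne_one (i : Fin n) : i.succ.succ ≠ 1 := by simp [Fin.ext_iff]

theorem xiBlock_mul_zero (j : Fin (n + 2)) :
    (xiBlock n a * X) 0 j = conj a * X 0 j + rho a * X 1 j := by
  rw [Matrix.mul_apply, Fin.sum_univ_succ, Fin.sum_univ_succ]
  simp [xiBlock, succ_succ_ne_one]

theorem xiBlock_mul_one (j : Fin (n + 2)) :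
    (xiBlock n a * X) 1 j = rho a * X 0 j - a * X 1 j := by
  rw [Matrix.mul_apply, Fin.sum_univ_succ, Fin.sum_univ_succ]
  simp [xiBlock, succ_succ_ne_one, sub_eq_add_neg]

theorem xiBlock_mul_succ_succ (i : Fin n) (j : Fin (n + 2)) :
    (xiBlock n a * X) i.succ.succ j = X i.succ.succ j := by
  rw [Matrix.mul_apply, Finset.sum_eq_single i.succ.succ]
  · simp [xiBlock, succ_succ_ne_one]
  · intro m _ hm
    simp [xiBlock, succ_succ_ne_one, hm.symm]
  · simp

theorem xiBlock_conjTranspose : (xiBlock n a)ᴴ = xiBlock n (conj a) := by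
  ext i j
  simp only [Matrix.conjTranspose_apply, xiBlock, Matrix.of_apply, rho_conj, apply_ite star]
  by_cases hi : i = 0 <;> by_cases hi' : i = 1 <;> by_cases hj : j = 0 <;> by_cases hj' : j = 1 <;>
    simp_all [eq_comm]

theorem xiBlock_mul_xiBlock_conj {a : ℂ} (ha : ‖a‖ ≤ 1) :
    xiBlock n a * xiBlock n (conj a) = 1 := by
  have hrho := rho_mul_self ha
  ext i j
  refine Fin.cases ?_ (fun i => Fin.cases ?_ (fun i => ?_) i) i
  · rw [xiBlock_mul_zero]
    by_cases hj : j = 0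
    · subst hj
      simp [xiBlock, rho_conj, hrho]
    · by_cases hj' : j = 1
      · simp [hj', xiBlock, rho_conj, mul_comm]
      · simp [hj, hj', xiBlock, Ne.symm hj]
  · rw [Fin.succ_zero_eq_one, xiBlock_mul_one]
    by_cases hj : j = 0
    · simp [hj, xiBlock, rho_conj, mul_comm]
    · by_cases hj' : j = 1
      · subst hj'
        simp [xiBlock, rho_conj, hrho, mul_comm]
      · simp [hj, hj', xiBlock, Ne.symm hj']
  · rw [xiBlock_mul_succ_succ]
    simp [xiBlock, Matrix.one_apply, succ_succ_ne_one]

theorem xiBlock_mem_unitaryGroup {a : ℂ} (ha : ‖a‖ ≤ 1) :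
    xiBlock n a ∈ Matrix.unitaryGroup (Fin (n + 2)) ℂ := by
  rw [Matrix.mem_unitaryGroup_iff, Matrix.star_eq_conjTranspose, xiBlock_conjTranspose]
  exact xiBlock_mul_xiBlock_conj ha

theorem det_xiBlock {a : ℂ} (ha : ‖a‖ ≤ 1) : (xiBlock n a).det = -1 := by
  have hminor0 : (xiBlock n a).submatrix Fin.succ (Fin.succAbove 0) =
      Matrix.diagonal (Fin.cons (-a) 1) := by
    ext i j
    cases i using Fin.cases <;> cases j using Fin.cases <;>
      simp [xiBlock, succ_succ_ne_one, Matrix.diagonal_apply, (Fin.succ_ne_zero _).symm]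
  have hminor1 : (xiBlock n a).submatrix Fin.succ (Fin.succAbove 1) =
      Matrix.diagonal (Fin.cons (rho a : ℂ) 1) := by
    ext i j
    cases i using Fin.cases <;> cases j using Fin.cases <;>
      simp [xiBlock, succ_succ_ne_one, Matrix.diagonal_apply, (Fin.succ_ne_zero _).symm]
  rw [Matrix.det_succ_row_zero, Fin.sum_univ_succ, Fin.sum_univ_succ, Fin.succ_zero_eq_one, hminor0,
    hminor1, Matrix.det_diagonal, Matrix.det_diagonal, Fin.prod_cons, Fin.prod_cons]
  simp only [xiBlock, Matrix.of_apply, Fin.succ_ne_zero, succ_succ_ne_one, one_ne_zero, if_true,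
    if_false, Fin.coe_ofNat_eq_mod, Nat.zero_mod, Nat.one_mod, Nat.succ_eq_add_one, pow_zero,
    pow_one, Pi.one_apply, Finset.prod_const_one, Finset.sum_const_zero, mul_zero, zero_mul,
    mul_one, one_mul, mul_neg, neg_mul, rho_mul_self ha]
  ring

end XiBlock

section Recursion

variable {n : ℕ} (a : ℂ)

theorem isVerblunsky_fin_one {α : Fin 1 → ℂ} : IsVerblunsky α ↔ ‖α 0‖ = 1 := by
  simp [IsVerblunsky]

theorem isVerblunsky_cons {a : ℂ} {α : Fin (n + 1) → ℂ} :
    IsVerblunsky (Fin.cons a α : Fin (n + 2) → ℂ) ↔ ‖a‖ < 1 ∧ IsVerblunsky α := by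
  simp [IsVerblunsky, Fin.forall_fin_succ]

theorem blockFactor_one_cons (α : Fin n → ℂ) :
    blockFactor 1 (Fin.cons a α : Fin (n + 1) → ℂ) = oneBlock (blockFactor 0 α) := by
  ext i j
  cases i using Fin.cases with
  | zero => cases j using Fin.cases <;> simp [blockFactor, (Fin.succ_ne_zero _).symm]
  | succ i =>
    cases j using Fin.cases with
    | zero => simp [blockFactor]
    | succ j =>
      obtain ⟨i, hi⟩ := i
      obtain ⟨j, hj⟩ := j
      rw [oneBlock_succ_succ]
      simp only [blockFactor, Matrix.of_apply, Fin.succ_mk, Fin.mk.injEq]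
      rcases i with _ | i <;> split_ifs <;> first | (exfalso; omega) | rfl | simp_all

theorem blockFactor_zero_cons (α : Fin (n + 1) → ℂ) :
    blockFactor 0 (Fin.cons a α : Fin (n + 2) → ℂ) = xiBlock n a * oneBlock (blockFactor 1 α) := by
  ext i j
  refine Fin.cases ?_ (fun i => Fin.cases ?_ (fun i => ?_) i) i
  · rw [xiBlock_mul_zero, ← Fin.succ_zero_eq_one]
    cases j using Fin.cases with
    | zero => simp [blockFactor]
    | succ j =>
      rw [oneBlock_succ_succ]
      cases j using Fin.cases <;> simp [blockFactor, (Fin.succ_ne_zero _).symm]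
  · rw [Fin.succ_zero_eq_one, xiBlock_mul_one, ← Fin.succ_zero_eq_one]
    cases j using Fin.cases with
    | zero => simp [blockFactor]
    | succ j =>
      rw [oneBlock_succ_succ]
      cases j using Fin.cases <;>
        simp [blockFactor, (succ_succ_ne_one _).symm, (Fin.succ_ne_zero _).symm]
  · rw [xiBlock_mul_succ_succ]
    cases j using Fin.cases with
    | zero => simp [blockFactor]
    | succ j =>
      obtain ⟨i, hi⟩ := i
      obtain ⟨j, hj⟩ := j
      rw [oneBlock_succ_succ]
      simp only [blockFactor, Matrix.of_apply, Fin.succ_mk, Fin.mk.injEq]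
      split_ifs <;> first | (exfalso; omega) | rfl

theorem blockFactor_transpose (p : ℕ) (α : Fin n → ℂ) : (blockFactor p α)ᵀ = blockFactor p α := by
  ext i j
  simp only [Matrix.transpose_apply, blockFactor, Matrix.of_apply]
  by_cases h : i = j
  · rw [h]
  · rw [if_neg h, if_neg (Ne.symm h)]
    split_ifs <;> first | (exfalso; omega) | rfl

theorem cmv_transpose (α : Fin n → ℂ) : (cmv α)ᵀ = blockFactor 1 α * blockFactor 0 α := by
  rw [cmv, Matrix.transpose_mul, blockFactor_transpose, blockFactor_transpose]

theorem cmv_cons (α : Fin (n + 1) → ℂ) :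
    cmv (Fin.cons a α : Fin (n + 2) → ℂ) = xiBlock n a * oneBlock (cmv α)ᵀ := by
  rw [cmv_transpose, oneBlock_mul, ← mul_assoc, ← blockFactor_zero_cons, ← blockFactor_one_cons,
    cmv]

theorem cmv_fin_one (α : Fin 1 → ℂ) : cmv α = Matrix.of fun _ _ => conj (α 0) := by
  ext i j
  rw [Subsingleton.elim i 0, Subsingleton.elim j 0]
  simp [cmv, blockFactor, Matrix.mul_apply]

theorem det_cmv {n : ℕ} {α : Fin (n + 1) → ℂ} (hα : ∀ j : Fin n, ‖α j.castSucc‖ ≤ 1) :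
    (cmv α).det = (-1) ^ n * conj (α (Fin.last n)) := by
  induction n with
  | zero => simp [cmv_fin_one]
  | succ n ih =>
    cases α using Fin.consCases with
    | cons a β =>
      have hβ : (cmv β).det = (-1) ^ n * conj (β (Fin.last n)) :=
        ih fun j => by simpa using hα j.succ
      rw [cmv_cons, Matrix.det_mul, det_oneBlock, Matrix.det_transpose, hβ,
        det_xiBlock (by simpa using hα 0), ← Fin.succ_last, Fin.cons_succ]
      ring

theorem cmv_mem_unitaryGroup {n : ℕ} {α : Fin n → ℂ} (hα : IsVerblunsky α) :
    cmv α ∈ Matrix.unitaryGroup (Fin n) ℂ := by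
  match n, α, hα with
  | 0, α, _ => exact Subsingleton.elim (1 : Matrix (Fin 0) (Fin 0) ℂ) (cmv α) ▸ one_mem _
  | 1, α, hα =>
    rw [isVerblunsky_fin_one] at hα
    rw [Matrix.mem_unitaryGroup_iff, cmv_fin_one]
    ext i j
    rw [Subsingleton.elim i 0, Subsingleton.elim j 0]
    simp [Matrix.mul_apply, Complex.conj_mul', hα]
  | n + 2, α, hα =>
    cases α using Fin.consCases with
    | cons a β =>
      obtain ⟨ha, hβ⟩ := isVerblunsky_cons.1 hα
      rw [cmv_cons]
      exact mul_mem (xiBlock_mem_unitaryGroup ha.le) (oneBlock_mem_unitaryGroup_iff.2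
        (Matrix.transpose_mem_unitaryGroup_iff.2 (cmv_mem_unitaryGroup hβ)))

end Recursion

/-! ### The shape of CMV matrices -/

section PosLower

variable {m 𝕜 : Type*} [LinearOrder m] [RCLike 𝕜]

/-- Lower triangular matrices with a positive diagonal, the triangular factors of an `LQ`
factorization. -/
structure IsPosLower (W : Matrix m m 𝕜) : Prop where
  isLowerTriangular : W.IsLowerTriangular
  diag_pos : ∀ i, 0 < W i i

namespace IsPosLower

variable {W : Matrix m m 𝕜}

theorem apply_eq_zero (hW : IsPosLower W) {i j : m} (h : i < j) : W i j = 0 :=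
  hW.isLowerTriangular h

variable [Fintype m]

theorem isUnit_det (hW : IsPosLower W) : IsUnit W.det := by
  rw [Matrix.det_of_isLowerTriangular W hW.isLowerTriangular, isUnit_iff_ne_zero]
  exact Finset.prod_ne_zero_iff.2 fun i _ => (hW.diag_pos i).ne'

theorem inv (hW : IsPosLower W) : IsPosLower W⁻¹ := by
  let := W.invertibleOfIsUnitDet hW.isUnit_det
  have hinv : W⁻¹.IsLowerTriangular :=
    Matrix.blockTriangular_inv_of_blockTriangular hW.isLowerTriangular
  refine ⟨hinv, fun i => ?_⟩
  have hdiag : W i i * W⁻¹ i i = 1 := by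
    rw [← Matrix.one_apply_eq i, ← Matrix.mul_nonsing_inv W hW.isUnit_det, Matrix.mul_apply,
      Finset.sum_eq_single i (fun k _ hk => ?_) (by simp)]
    rcases lt_or_gt_of_ne hk with hki | hik
    · rw [hinv hki, mul_zero]
    · rw [hW.apply_eq_zero hik, zero_mul]
  exact (pos_iff_pos_of_mul_pos (hdiag ▸ one_pos)).1 (hW.diag_pos i)

end IsPosLower

end PosLower

/-- Matrices `B` whose nonzero entries lie under the staircase that reaches up to the column
`r i` in row `i`, with positive entries at the corners, i.e. where the staircase reaches a column
for the first time. -/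
structure IsStaircase {n : ℕ} (r : Fin n → ℕ) (B : Matrix (Fin n) (Fin n) ℂ) : Prop where
  apply_eq_zero : ∀ {i j : Fin n}, r i < j → B i j = 0
  corner_pos : ∀ {i j : Fin n}, r i = j → (∀ m < i, r m < j) → 0 < B i j

/-- The staircase `i + 2, i + 1, i + 4, i + 3, …` of products of two block factors of opposite
parities, the first one of parity `p`. -/
def reach (p : ℕ) {n : ℕ} (i : Fin n) : ℕ := i + 2 - (i + p) % 2

theorem reach_monotone (p : ℕ) {n : ℕ} : Monotone (reach p (n := n)) := fun i j h => by
  have : (i : ℕ) ≤ j := h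
  simp only [reach]
  omega

section Staircase

variable {n : ℕ} {r : Fin n → ℕ} {B W : Matrix (Fin n) (Fin n) ℂ}

theorem IsStaircase.posLower_mul (hr : Monotone r) (hB : IsStaircase r B) (hW : IsPosLower W) :
    IsStaircase r (W * B) where
  apply_eq_zero {i j} hij := by
    rw [Matrix.mul_apply]
    refine Finset.sum_eq_zero fun m _ => ?_
    rcases le_or_gt m i with hm | hm
    · rw [hB.apply_eq_zero ((hr hm).trans_lt hij), mul_zero]
    · rw [hW.apply_eq_zero hm, zero_mul]
  corner_pos {i j} hij hcorner := by
    rw [Matrix.mul_apply, Finset.sum_eq_single i (fun m _ hm => ?_) (by simp)]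
    · exact mul_pos (hW.diag_pos i) (hB.corner_pos hij hcorner)
    · rcases lt_or_gt_of_ne hm with hm | hm
      · rw [hB.apply_eq_zero (hcorner m hm), mul_zero]
      · rw [hW.apply_eq_zero hm, zero_mul]

theorem IsStaircase.mul_posLower (hB : IsStaircase r B) (hW : IsPosLower W) :
    IsStaircase r (B * W) where
  apply_eq_zero {i j} hij := by
    rw [Matrix.mul_apply]
    refine Finset.sum_eq_zero fun m _ => ?_
    rcases le_or_gt j m with hm | hm
    · rw [hB.apply_eq_zero (hij.trans_le hm), zero_mul]
    · rw [hW.apply_eq_zero hm, mul_zero]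
  corner_pos {i j} hij hcorner := by
    rw [Matrix.mul_apply, Finset.sum_eq_single j (fun m _ hm => ?_) (by simp)]
    · exact mul_pos (hB.corner_pos hij hcorner) (hW.diag_pos j)
    · rcases lt_or_gt_of_ne hm with hm | hm
      · rw [hW.apply_eq_zero hm, mul_zero]
      · rw [hB.apply_eq_zero (hij.trans_lt hm), zero_mul]

theorem IsStaircase.of_mul_posLower_eq {B' : Matrix (Fin n) (Fin n) ℂ} (hr : Monotone r)
    (hB : IsStaircase r B) (hW : IsPosLower W) (h : B' * W = W * B) : IsStaircase r B' := by
  rw [← Matrix.mul_nonsing_inv_cancel_right W B' hW.isUnit_det, h]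
  exact (hB.posLower_mul hr hW).mul_posLower hW.inv

end Staircase

section Cmv

variable {n : ℕ} {α : Fin n → ℂ}

theorem blockFactor_apply_eq_zero (p : ℕ) (α : Fin n → ℂ) {i j : Fin n}
    (h : i.val + 1 - (i + p) % 2 < j ∨ j.val + 1 - (j + p) % 2 < i) : blockFactor p α i j = 0 := by
  simp only [blockFactor, Matrix.of_apply, Fin.ext_iff]
  rw [if_neg (by omega), if_neg (by omega), if_neg (by omega)]

theorem blockFactor_apply_of_add_one_eq {p : ℕ} (α : Fin n → ℂ) {i j : Fin n}
    (hij : i.val + 1 = j) (hi : (i.val + p) % 2 = 0) : blockFactor p α i j = rho (α i) := by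
  simp only [blockFactor, Matrix.of_apply, Fin.ext_iff]
  rw [if_neg (by omega), if_pos ⟨hij, by omega⟩]

theorem IsVerblunsky.norm_lt_one (hα : IsVerblunsky α) {i : Fin n} (hi : i.val + 1 < n) :
    ‖α i‖ < 1 := by
  simpa [hi] using hα i

theorem IsVerblunsky.norm_le_one (hα : IsVerblunsky α) (i : Fin n) : ‖α i‖ ≤ 1 := by
  have := hα i
  split_ifs at this
  exacts [this.le, this.le]

theorem isStaircase_blockFactor_mul (hα : IsVerblunsky α) {p q : ℕ} (hpq : (p + q) % 2 = 1) :
    IsStaircase (reach p) (blockFactor p α * blockFactor q α) := by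
  have hrho : ∀ i : Fin n, i.val + 1 < n → (0 : ℂ) < rho (α i) := fun i hi =>
    Complex.zero_lt_real.2 (rho_pos (hα.norm_lt_one hi))
  refine ⟨fun {i j} hij => ?_, fun {i j} hij hcorner => ?_⟩
  · rw [Matrix.mul_apply]
    refine Finset.sum_eq_zero fun m _ => ?_
    simp only [reach] at hij
    rcases lt_or_ge (i.val + 1 - (i + p) % 2) m with hm | hm
    · rw [blockFactor_apply_eq_zero p α (.inl hm), zero_mul]
    · rw [blockFactor_apply_eq_zero q α (.inl (by omega)), mul_zero]
  · simp only [reach] at hij hcorner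
    rcases Nat.mod_two_eq_zero_or_one (i + p) with hi | hi
    · let i' : Fin n := ⟨i + 1, by omega⟩
      have hi' : i'.val = i + 1 := rfl
      rw [Matrix.mul_apply, Finset.sum_eq_single i' (fun m _ hm => ?_) (by simp),
        blockFactor_apply_of_add_one_eq α hi'.symm hi,
        blockFactor_apply_of_add_one_eq (i := i') α (by omega) (by omega)]
      · exact mul_pos (hrho i (by omega)) (hrho i' (by omega))
      · have hm' : m.val ≠ i + 1 := fun h => hm (Fin.ext h)
        rcases lt_or_ge (i.val + 1) m with hm | hm
        · rw [blockFactor_apply_eq_zero p α (.inl (by omega)), zero_mul]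
        · rw [blockFactor_apply_eq_zero q α (.inl (by omega)), mul_zero]
    · have hi0 : i.val = 0 := by
        by_contra h0
        have := hcorner ⟨i - 1, by omega⟩ (Fin.lt_def.2 (by simp only; omega))
        simp only at this
        omega
      have hdiag : blockFactor p α i i = 1 := by
        simp only [blockFactor, Matrix.of_apply, if_pos, hi0, show ¬ 0 % 2 = p % 2 by omega,
          if_false]
      rw [Matrix.mul_apply, Finset.sum_eq_single i (fun m _ hm => ?_) (by simp), hdiag, one_mul,
        blockFactor_apply_of_add_one_eq α (by omega) (by omega)]
      · exact hrho i (by omega)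
      · have hm' : m.val ≠ i := fun h => hm (Fin.ext h)
        rw [blockFactor_apply_eq_zero p α (.inl (by omega)), zero_mul]

theorem isStaircase_cmv (hα : IsVerblunsky α) : IsStaircase (reach 0) (cmv α) :=
  isStaircase_blockFactor_mul hα rfl

theorem isStaircase_cmv_transpose (hα : IsVerblunsky α) : IsStaircase (reach 1) (cmv α)ᵀ :=
  cmv_transpose α ▸ isStaircase_blockFactor_mul hα rfl

theorem blockFactor_submatrix_castLE {k : ℕ} (p : ℕ) (hk : k ≤ n) (α : Fin n → ℂ) :
    (blockFactor p α).submatrix (Fin.castLE hk) (Fin.castLE hk) =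
      blockFactor p fun i => α (Fin.castLE hk i) := by
  ext i j
  simp only [Matrix.submatrix_apply, blockFactor, Matrix.of_apply, Fin.ext_iff, Fin.val_castLE]
  rfl

theorem cmv_submatrix_castLE {k : ℕ} (hk : k ≤ n) (α : Fin n → ℂ) :
    (cmv α).submatrix (Fin.castLE hk) (Fin.castLE hk) = cmv fun i => α (Fin.castLE hk i) := by
  ext i j
  rw [Matrix.submatrix_apply, cmv, cmv, Matrix.mul_apply, Matrix.mul_apply,
    ← blockFactor_submatrix_castLE 0 hk, ← blockFactor_submatrix_castLE 1 hk]
  refine (Fintype.sum_of_injective _ (Fin.castLE_injective hk) _ _ (fun m hm => ?_)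
    fun m => rfl).symm
  have hkm : k ≤ m := not_lt.1 fun hlt => hm ⟨⟨m, hlt⟩, rfl⟩
  have hi : (Fin.castLE hk i : ℕ) < k := i.isLt
  have hj : (Fin.castLE hk j : ℕ) < k := j.isLt
  rcases Nat.lt_or_ge ((Fin.castLE hk i : ℕ) + 1 - (Fin.castLE hk i + 0) % 2) m with h | h
  · rw [blockFactor_apply_eq_zero 0 α (.inl h), zero_mul]
  · rw [blockFactor_apply_eq_zero 1 α (.inr (by omega)), mul_zero]

theorem det_cmv_submatrix_castLE (hα : IsVerblunsky α) (a : Fin n) (ha : a.val + 1 ≤ n) :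
    ((cmv α).submatrix (Fin.castLE ha) (Fin.castLE ha)).det = (-1) ^ a.val * conj (α a) := by
  rw [cmv_submatrix_castLE, det_cmv fun j => hα.norm_le_one _]
  rfl

end Cmv

section Reconstruction

variable {n : ℕ}

theorem sum_norm_apply_sq_eq_one {m 𝕜 : Type*} [Fintype m] [DecidableEq m] [RCLike 𝕜]
    {D : Matrix m m 𝕜} (hD : D ∈ Matrix.unitaryGroup m 𝕜) (i : m) : ∑ j, ‖D i j‖ ^ 2 = 1 := by
  have hdiag := congrFun (congrFun (Matrix.mem_unitaryGroup_iff.1 hD) i) i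
  simp only [Matrix.mul_apply, Matrix.star_apply, RCLike.star_def, RCLike.mul_conj,
    Matrix.one_apply_eq] at hdiag
  exact_mod_cast hdiag

theorem apply_eq_zero_of_norm_apply_eq_one {m 𝕜 : Type*} [Fintype m] [DecidableEq m] [RCLike 𝕜]
    {D : Matrix m m 𝕜} (hD : D ∈ Matrix.unitaryGroup m 𝕜) {i j : m} (hij : ‖D i j‖ = 1) :
    (∀ k ≠ i, D k j = 0) ∧ ∀ k ≠ j, D i k = 0 := by
  suffices h : ∀ {D : Matrix m m 𝕜}, D ∈ Matrix.unitaryGroup m 𝕜 → ∀ {i j}, ‖D i j‖ = 1 →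
      ∀ k ≠ j, D i k = 0 from
    ⟨h (Matrix.transpose_mem_unitaryGroup_iff.2 hD) hij, h hD hij⟩
  intro D hD i j hij k hk
  have hrow := sum_norm_apply_sq_eq_one hD i
  rw [← Finset.add_sum_erase _ _ (Finset.mem_univ j), hij, one_pow, add_eq_left,
    Finset.sum_eq_zero_iff_of_nonneg fun _ _ => sq_nonneg _] at hrow
  simpa using hrow k (Finset.mem_erase.2 ⟨hk, Finset.mem_univ k⟩)

theorem exists_unitary_eq_oneBlock {D : Matrix (Fin (n + 1)) (Fin (n + 1)) ℂ}
    (hD : D ∈ Matrix.unitaryGroup (Fin (n + 1)) ℂ) (h00 : D 0 0 = 1) :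
    ∃ N ∈ Matrix.unitaryGroup (Fin n) ℂ, D = oneBlock N := by
  obtain ⟨hcol, hrow⟩ := apply_eq_zero_of_norm_apply_eq_one hD (i := 0) (j := 0) (by simp [h00])
  have hblock : D = oneBlock (D.submatrix Fin.succ Fin.succ) := by
    ext i j
    cases i using Fin.cases <;> cases j using Fin.cases <;>
      simp [h00, hcol, hrow, Fin.succ_ne_zero]
  exact ⟨_, oneBlock_mem_unitaryGroup_iff.1 (hblock ▸ hD), hblock⟩

theorem exists_unitary_eq_xiBlock_mul_oneBlock {B : Matrix (Fin (n + 2)) (Fin (n + 2)) ℂ}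
    (hB : B ∈ Matrix.unitaryGroup (Fin (n + 2)) ℂ) (hpos : 0 < B 1 0)
    (hcol : ∀ i : Fin n, B i.succ.succ 0 = 0) :
    ∃ a, ‖a‖ < 1 ∧ ∃ N ∈ Matrix.unitaryGroup (Fin (n + 1)) ℂ, B = xiBlock n a * oneBlock N := by
  have hnorm : ‖B 0 0‖ ^ 2 + ‖B 1 0‖ ^ 2 = 1 := by
    simpa [Fin.sum_univ_succ, hcol] using
      sum_norm_apply_sq_eq_one (Matrix.transpose_mem_unitaryGroup_iff.2 hB) 0
  have hpos' : 0 < ‖B 1 0‖ := norm_pos_iff.2 hpos.ne'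
  have ha : ‖conj (B 0 0)‖ < 1 := by
    rw [RCLike.norm_conj]
    nlinarith [norm_nonneg (B 0 0)]
  have hrho : (rho (B 0 0) : ℂ) = B 1 0 := by
    rw [rho, ← hnorm, add_sub_cancel_left, Real.sqrt_sq hpos'.le]
    exact (Complex.eq_coe_norm_of_nonneg hpos.le).symm
  have hcorner : (xiBlock n (B 0 0) * B) 0 0 = 1 := by
    rw [xiBlock_mul_zero, ← hrho, rho_mul_self (RCLike.norm_conj (B 0 0) ▸ ha.le)]
    ring
  obtain ⟨N, hN, hBN⟩ := exists_unitary_eq_oneBlock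
    (mul_mem (xiBlock_mem_unitaryGroup (RCLike.norm_conj (B 0 0) ▸ ha.le)) hB) hcorner
  refine ⟨conj (B 0 0), ha, N, hN, ?_⟩
  have hinv := xiBlock_mul_xiBlock_conj (n := n) ha.le
  rw [Complex.conj_conj] at hinv
  rw [← hBN, ← mul_assoc, hinv, one_mul]

variable {a : ℂ} {N : Matrix (Fin (n + 1)) (Fin (n + 1)) ℂ}

theorem isStaircase_of_xiBlock_mul_oneBlock (ha : ‖a‖ < 1)
    (h : IsStaircase (reach 0) (xiBlock n a * oneBlock N)) : IsStaircase (reach 1) N := by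
  have hrho : (0 : ℂ) < rho a := Complex.zero_lt_real.2 (rho_pos ha)
  have hrow0 : ∀ j : Fin (n + 1), (xiBlock n a * oneBlock N) 0 j.succ = rho a * N 0 j := by
    intro j
    rw [xiBlock_mul_zero, ← Fin.succ_zero_eq_one, oneBlock_zero_succ, oneBlock_succ_succ, mul_zero,
      zero_add]
  have hrow : ∀ (i : Fin n) (j : Fin (n + 1)),
      (xiBlock n a * oneBlock N) i.succ.succ j.succ = N i.succ j := fun i j => by
    rw [xiBlock_mul_succ_succ, oneBlock_succ_succ]
  refine ⟨fun {i j} hij => ?_, fun {i j} hij hcorner => ?_⟩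
  · cases i using Fin.cases with
    | zero =>
      refine (mul_eq_zero_iff_left hrho.ne').1 ((hrow0 j).symm.trans (h.apply_eq_zero ?_))
      simp only [reach, Fin.val_zero, Fin.val_succ] at hij ⊢
      omega
    | succ i =>
      rw [← hrow, h.apply_eq_zero]
      simp only [reach, Fin.val_succ] at hij ⊢
      omega
  · simp only [reach] at hij hcorner
    cases i using Fin.cases with
    | zero =>
      refine (pos_iff_pos_of_mul_pos (hrow0 j ▸ h.corner_pos ?_ fun m hm => ?_)).1 hrho
      · simp only [reach, Fin.val_zero, Fin.val_succ] at hij ⊢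
        omega
      · simp at hm
    | succ i =>
      rw [← hrow]
      refine h.corner_pos ?_ fun m hm => ?_
      · simp only [reach, Fin.val_succ] at hij ⊢
        omega
      · simp only [Fin.val_succ] at hij
        refine Fin.cases ?_ (fun m => Fin.cases ?_ (fun m hm => ?_) m) m hm
        · simp only [reach, Fin.val_zero, Fin.val_succ]
          omega
        · simp only [reach, Fin.val_zero, Fin.val_succ]
          omega
        · have := hcorner m.succ (Fin.succ_lt_succ_iff.1 hm)
          simp only [reach, Fin.val_succ] at this ⊢
          omega

theorem isStaircase_transpose_of_xiBlock_mul_oneBlock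
    (h : IsStaircase (reach 1) (xiBlock n a * oneBlock N)ᵀ) : IsStaircase (reach 0) Nᵀ := by
  have hrow : ∀ (i : Fin (n + 1)) (j : Fin n),
      Nᵀ i j.succ = (xiBlock n a * oneBlock N)ᵀ i.succ j.succ.succ := fun i j => by
    rw [Matrix.transpose_apply, Matrix.transpose_apply, xiBlock_mul_succ_succ, oneBlock_succ_succ]
  refine ⟨fun {i j} hij => ?_, fun {i j} hij hcorner => ?_⟩ <;>
    simp only [reach] at hij <;>
    obtain ⟨j, rfl⟩ := Fin.exists_succ_eq.2 (show j ≠ 0 by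
      rintro rfl
      rw [Fin.val_zero] at hij
      omega)
  · rw [hrow]
    refine h.apply_eq_zero ?_
    simp only [reach, Fin.val_succ] at hij ⊢
    omega
  · rw [hrow]
    refine h.corner_pos ?_ fun m hm => ?_
    · simp only [reach, Fin.val_succ] at hij ⊢
      omega
    · cases m using Fin.cases with
      | zero => simp [reach]
      | succ m =>
        have := hcorner m (Fin.succ_lt_succ_iff.1 hm)
        simp only [reach, Fin.val_succ] at this ⊢
        omega

theorem exists_eq_cmv : ∀ {n : ℕ} {B : Matrix (Fin (n + 1)) (Fin (n + 1)) ℂ},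
    B ∈ Matrix.unitaryGroup (Fin (n + 1)) ℂ → IsStaircase (reach 0) B → IsStaircase (reach 1) Bᵀ →
      ∃ α, IsVerblunsky α ∧ B = cmv α
  | 0, B, hB, _, _ => by
    refine ⟨fun _ => conj (B 0 0), isVerblunsky_fin_one.2 ?_, ?_⟩
    · rw [RCLike.norm_conj, ← pow_eq_one_iff_of_nonneg (norm_nonneg _) two_ne_zero]
      simpa only [Fin.sum_univ_succ, Fin.sum_univ_zero, add_zero] using
        sum_norm_apply_sq_eq_one hB 0
    · ext i j
      rw [cmv_fin_one, Fin.fin_one_eq_zero i, Fin.fin_one_eq_zero j, Matrix.of_apply,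
        Complex.conj_conj]
  | n + 1, B, hB, h0, h1 => by
    obtain ⟨a, ha, N, hN, rfl⟩ := exists_unitary_eq_xiBlock_mul_oneBlock hB
      (h1.corner_pos (i := 0) (j := 1) rfl (by simp))
      fun i => h1.apply_eq_zero (i := 0) (j := i.succ.succ) (by simp [reach])
    obtain ⟨β, hβ, hNβ⟩ := exists_eq_cmv (Matrix.transpose_mem_unitaryGroup_iff.2 hN)
      (isStaircase_transpose_of_xiBlock_mul_oneBlock h1)
      (isStaircase_of_xiBlock_mul_oneBlock ha h0)
    exact ⟨Fin.cons a β, isVerblunsky_cons.2 ⟨ha, hβ⟩, by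
      rw [cmv_cons, ← hNβ, Matrix.transpose_transpose]⟩

end Reconstruction

/-! ### The Lax equation of the flow -/

section EntryDeriv

variable {n : ℕ}

/-- The entrywise derivative of a matrix-valued function of a real variable; it does not depend on
the choice of a norm on the matrices. -/
def HasEntryDeriv (X : ℝ → Matrix (Fin n) (Fin n) ℂ) (X' : Matrix (Fin n) (Fin n) ℂ) (s : Set ℝ)
    (t : ℝ) : Prop :=
  ∀ i j, HasDerivWithinAt (fun u => X u i j) (X' i j) s t

variable {X Y : ℝ → Matrix (Fin n) (Fin n) ℂ} {X' Y' : Matrix (Fin n) (Fin n) ℂ} {s : Set ℝ} {t : ℝ}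

theorem hasEntryDeriv_const (M : Matrix (Fin n) (Fin n) ℂ) (s : Set ℝ) (t : ℝ) :
    HasEntryDeriv (fun _ => M) 0 s t :=
  fun _ _ => hasDerivWithinAt_const _ _ _

theorem HasEntryDeriv.sub (hX : HasEntryDeriv X X' s t) (hY : HasEntryDeriv Y Y' s t) :
    HasEntryDeriv (fun u => X u - Y u) (X' - Y') s t :=
  fun i j => (hX i j).sub (hY i j)

theorem HasEntryDeriv.mul (hX : HasEntryDeriv X X' s t) (hY : HasEntryDeriv Y Y' s t) :
    HasEntryDeriv (fun u => X u * Y u) (X' * Y t + X t * Y') s t := by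
  intro i j
  simp only [Matrix.mul_apply, Matrix.add_apply, ← Finset.sum_add_distrib]
  exact HasDerivWithinAt.fun_sum fun m _ => (hX i m).mul (hY m j)

theorem HasEntryDeriv.conjTranspose (hX : HasEntryDeriv X X' s t) :
    HasEntryDeriv (fun u => (X u)ᴴ) X'ᴴ s t :=
  fun i j => (hX j i).star

theorem eq_of_hasDerivWithinAt_Ici_zero {E : Type*} [NormedAddCommGroup E] [NormedSpace ℝ E]
    {y : ℝ → E} (h : ∀ t, 0 ≤ t → HasDerivWithinAt y 0 (Set.Ici 0) t) {t : ℝ} (ht : 0 ≤ t) :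
    y t = y 0 :=
  constant_of_has_deriv_right_zero
    (fun u hu => ((h u hu.1).continuousWithinAt).mono Set.Icc_subset_Ici_self)
    (fun u hu => (h u hu.1).mono (Set.Ici_subset_Ici.2 hu.1)) t ⟨ht, le_rfl⟩

theorem eq_of_hasEntryDeriv_Ici_zero (h : ∀ t, 0 ≤ t → HasEntryDeriv X 0 (Set.Ici 0) t)
    (ht : 0 ≤ t) : X t = X 0 := by
  ext i j
  exact eq_of_hasDerivWithinAt_Ici_zero (fun u hu => h u hu i j) ht

end EntryDeriv

section Lax

variable {n : ℕ}

theorem pairing_grad_linear (ψ : Matrix (Fin n) (Fin n) ℂ →ₗ[ℝ] ℝ)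
    (B V : Matrix (Fin n) (Fin n) ℂ) : pairing (grad ψ B) V = ψ V := by
  have hline : ∀ v, lineDeriv ℝ ψ B v = ψ v := by
    intro v
    have : HasDerivAt (fun t : ℝ => ψ (B + t • v)) (ψ v) 0 := by
      simp only [map_add, map_smul, smul_eq_mul]
      simpa using ((hasDerivAt_id (0 : ℝ)).mul_const (ψ v)).const_add (ψ B)
    exact this.deriv
  have hsingle : ∀ l k, ψ (Matrix.single l k (V l k))
      = (V l k).im * ψ (Matrix.single l k Complex.I) + (V l k).re * ψ (Matrix.single l k 1) := by
    intro l k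
    rw [← smul_eq_mul, ← smul_eq_mul, ← map_smul, ← map_smul, ← map_add, Matrix.smul_single,
      Matrix.smul_single, ← Matrix.single_add]
    congr 2
    apply Complex.ext <;> simp
  conv_rhs => rw [Matrix.matrix_eq_sum_single V]
  simp only [map_sum, hsingle]
  rw [Finset.sum_comm]
  simp only [pairing, Matrix.trace, Matrix.diag, Matrix.mul_apply, Complex.im_sum]
  refine Finset.sum_congr rfl fun k _ => Finset.sum_congr rfl fun l _ => ?_
  simp only [grad, hline, Matrix.of_apply, Complex.mul_im, Complex.add_re, Complex.add_im,
    Complex.mul_re, Complex.ofReal_re, Complex.ofReal_im, Complex.I_re, Complex.I_im]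
  ring

section

attribute [local instance] Matrix.linftyOpNormedRing Matrix.linftyOpNormedAlgebra

theorem hasDerivAt_trace_add_smul_pow (B V : Matrix (Fin n) (Fin n) ℂ) (m : ℕ) :
    HasDerivAt (fun s : ℝ => ((B + s • V) ^ m).trace) (m * (B ^ (m - 1) * V).trace) 0 := by
  have hline := (((hasDerivAt_id (0 : ℝ)).smul_const V).const_add B).congr_deriv (one_smul ℝ V)
  have hpow := (LinearMap.toContinuousLinearMap
    ((Matrix.traceLinearMap (Fin n) ℂ ℂ).restrictScalars ℝ)).hasFDerivAt.comp_hasDerivAt (0 : ℝ)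
      (hline.fun_pow' m)
  refine hpow.congr_deriv ?_
  have hterm : ∀ i ∈ Finset.range m,
      (B ^ (m.pred - i) * V * B ^ i).trace = (B ^ (m - 1) * V).trace := by
    intro i hi
    have him : i + (m.pred - i) = m - 1 := by
      have := Finset.mem_range.1 hi
      simp only [Nat.pred_eq_sub_one]
      omega
    rw [Matrix.trace_mul_comm, ← mul_assoc, ← pow_add, him]
  change Matrix.trace (∑ i ∈ Finset.range m,
    (B + (0 : ℝ) • V) ^ (m.pred - i) * V * (B + (0 : ℝ) • V) ^ i) = _
  rw [zero_smul, add_zero, Matrix.trace_sum, Finset.sum_congr rfl hterm,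
    Finset.sum_const, Finset.card_range, nsmul_eq_mul]

end

theorem hasDerivAt_trace_aeval_add_smul (f : Polynomial ℂ) (B V : Matrix (Fin n) (Fin n) ℂ) :
    HasDerivAt (fun s : ℝ => (Polynomial.aeval (B + s • V) f).trace)
      (Polynomial.aeval B f.derivative * V).trace 0 := by
  induction f using Polynomial.induction_on' with
  | add p q hp hq => simpa [add_mul] using hp.fun_add hq
  | monomial m c =>
    have := (hasDerivAt_trace_add_smul_pow B V m).const_mul c
    simp only [Polynomial.aeval_monomial, Polynomial.derivative_monomial,
      ← Algebra.smul_def, Matrix.trace_smul, smul_eq_mul, smul_mul_assoc]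
    rwa [mul_assoc]

theorem lineDeriv_hamiltonian (f : Polynomial ℂ) (B V : Matrix (Fin n) (Fin n) ℂ) :
    lineDeriv ℝ (hamiltonian f) B V = pairing (Polynomial.aeval B f.derivative) V :=
  (Complex.imCLM.hasFDerivAt.comp_hasDerivAt (0 : ℝ)
    (hasDerivAt_trace_aeval_add_smul f B V)).deriv

theorem grad_hamiltonian (f : Polynomial ℂ) (B : Matrix (Fin n) (Fin n) ℂ) :
    grad (hamiltonian f) B = Polynomial.aeval B f.derivative := by
  ext k l
  simp only [grad, Matrix.of_apply, lineDeriv_hamiltonian, pairing, Matrix.trace_mul_single]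
  apply Complex.ext <;> simp

/-- The polynomial `z f'(z)`, which drives the Lax equation of the Hamiltonian `Im tr f`. -/
def eulerPoly (f : Polynomial ℂ) : Polynomial ℂ := Polynomial.X * f.derivative

theorem commute_aeval {R A : Type*} [CommSemiring R] [Semiring A] [Algebra R A]
    (p : Polynomial R) (a : A) : Commute a (Polynomial.aeval a p) := by
  simpa using (Polynomial.commute_X p).map (Polynomial.aeval a)

theorem bracket_hamiltonian_linear (f : Polynomial ℂ) (ψ : Matrix (Fin n) (Fin n) ℂ →ₗ[ℝ] ℝ)
    (B : Matrix (Fin n) (Fin n) ℂ) :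
    bracket (hamiltonian f) ψ B = ψ (B * projL (Polynomial.aeval B (eulerPoly f))
      - projL (Polynomial.aeval B (eulerPoly f)) * B) := by
  set G := Polynomial.aeval B (eulerPoly f) with hG
  set Y := grad ψ B with hY
  have hBG : B * G = G * B := (commute_aeval _ B).eq
  have hright : B * Polynomial.aeval B f.derivative = G := by simp [hG, eulerPoly]
  have hleft : Polynomial.aeval B f.derivative * B = G := by
    rw [← hright, (commute_aeval _ B).eq]
  have hR : rMatrix G = projL G + projL G - G := by
    simp only [rMatrix, projL]
    abel
  have hYB : pairing (rMatrix G) (Y * B) = pairing Y (B * rMatrix G) := by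
    rw [pairing, pairing, Matrix.trace_mul_comm, mul_assoc]
  have hBY : pairing (rMatrix G) (B * Y) = pairing Y (rMatrix G * B) := by
    rw [pairing, pairing, ← mul_assoc, Matrix.trace_mul_comm]
  rw [bracket, grad_hamiltonian, hleft, hright, ← hY, ← pairing_grad_linear ψ B, ← hY, hYB, hBY, hR]
  simp only [pairing, mul_sub, mul_add, sub_mul, add_mul, Matrix.trace_sub, Matrix.trace_add,
    Complex.sub_im, Complex.add_im, hBG]
  ring

section

attribute [local instance] Matrix.normedAddCommGroup Matrix.normedSpace

theorem IsTrajectory.hasDerivWithinAt_linear {f : Polynomial ℂ}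
    {C : ℝ → Matrix (Fin n) (Fin n) ℂ} (hC : IsTrajectory (hamiltonian f) C)
    (ψ : Matrix (Fin n) (Fin n) ℂ →ₗ[ℝ] ℝ) {t : ℝ} (ht : 0 ≤ t) :
    HasDerivWithinAt (fun s => ψ (C s))
      (ψ (C t * projL (Polynomial.aeval (C t) (eulerPoly f))
        - projL (Polynomial.aeval (C t) (eulerPoly f)) * C t)) (Set.Ici 0) t := by
  rw [← bracket_hamiltonian_linear]
  exact hC ψ (LinearMap.toContinuousLinearMap ψ).contDiff t ht

end

theorem IsTrajectory.hasEntryDeriv {f : Polynomial ℂ} {C : ℝ → Matrix (Fin n) (Fin n) ℂ}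
    (hC : IsTrajectory (hamiltonian f) C) {t : ℝ} (ht : 0 ≤ t) :
    HasEntryDeriv C (C t * projL (Polynomial.aeval (C t) (eulerPoly f))
      - projL (Polynomial.aeval (C t) (eulerPoly f)) * C t) (Set.Ici 0) t := by
  intro i j
  let entry : Matrix (Fin n) (Fin n) ℂ →ₗ[ℝ] ℂ := Matrix.entryLinearMap ℝ ℂ i j
  have hre := hC.hasDerivWithinAt_linear (Complex.reLm ∘ₗ entry) ht
  have him := hC.hasDerivWithinAt_linear (Complex.imLm ∘ₗ entry) ht
  have hsum := hre.ofReal_comp.add (him.ofReal_comp.mul_const Complex.I)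
  exact (hsum.congr_deriv (Complex.re_add_im _)).congr (fun u _ => (Complex.re_add_im _).symm)
    (Complex.re_add_im _).symm

end Lax

/-! ### Lower triangular linear differential equations -/

section ScalarEquation

theorem hasDerivAt_exp_integral {a : ℝ → ℂ} (ha : Continuous a) (t : ℝ) :
    HasDerivAt (fun t => Complex.exp (∫ u in (0 : ℝ)..t, a u))
      (Complex.exp (∫ u in (0 : ℝ)..t, a u) * a t) t :=
  (ha.integral_hasStrictDerivAt 0 t).hasDerivAt.cexp

theorem eq_zero_of_hasDerivWithinAt {a y : ℝ → ℂ} (ha : Continuous a) (h0 : y 0 = 0)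
    (hy : ∀ t, 0 ≤ t → HasDerivWithinAt y (-(a t * y t)) (Set.Ici 0) t) {t : ℝ} (ht : 0 ≤ t) :
    y t = 0 := by
  have hconst := eq_of_hasDerivWithinAt_Ici_zero
    (y := fun t => Complex.exp (∫ u in (0 : ℝ)..t, a u) * y t) (fun t ht =>
      (((hasDerivAt_exp_integral ha t).hasDerivWithinAt).mul (hy t ht)).congr_deriv (by ring)) ht
  simpa [h0] using hconst

/-- The solution of the scalar equation `y' = -a y - S` with `y(0) = c`. -/
def scalarSolution (a S : ℝ → ℂ) (c : ℂ) (t : ℝ) : ℂ :=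
  Complex.exp (-∫ u in (0 : ℝ)..t, a u) *
    (c - ∫ u in (0 : ℝ)..t, Complex.exp (∫ v in (0 : ℝ)..u, a v) * S u)

variable {a S : ℝ → ℂ}

theorem scalarSolution_zero (a S : ℝ → ℂ) (c : ℂ) : scalarSolution a S c 0 = c := by
  simp [scalarSolution]

theorem scalarSolution_of_forall_eq_zero (hS : ∀ t, S t = 0) (c : ℂ) (t : ℝ) :
    scalarSolution a S c t = Complex.exp (-∫ u in (0 : ℝ)..t, a u) * c := by
  simp [scalarSolution, hS]

theorem hasDerivAt_scalarSolution (ha : Continuous a) (hS : Continuous S) (c : ℂ) (t : ℝ) :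
    HasDerivAt (scalarSolution a S c) (-(a t * scalarSolution a S c t) - S t) t := by
  have hcont : Continuous fun t => Complex.exp (∫ u in (0 : ℝ)..t, a u) :=
    continuous_iff_continuousAt.2 fun t => (hasDerivAt_exp_integral ha t).continuousAt
  have hexp : HasDerivAt (fun t => Complex.exp (-∫ u in (0 : ℝ)..t, a u))
      (Complex.exp (-∫ u in (0 : ℝ)..t, a u) * -a t) t :=
    (ha.integral_hasStrictDerivAt 0 t).hasDerivAt.neg.cexp
  have hint := ((hcont.mul hS).integral_hasStrictDerivAt 0 t).hasDerivAt
  refine (hexp.mul (hint.const_sub c)).congr_deriv ?_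
  have hcancel : Complex.exp (-∫ u in (0 : ℝ)..t, a u) *
      Complex.exp (∫ u in (0 : ℝ)..t, a u) = 1 := by
    rw [← Complex.exp_add, neg_add_cancel, Complex.exp_zero]
  simp only [scalarSolution, Pi.mul_apply]
  linear_combination (-S t) * hcancel

end ScalarEquation

section LowerEquation

variable {n : ℕ}

theorem mul_apply_of_isLowerTriangular {R : Type*} [NonUnitalNonAssocSemiring R]
    {L : Matrix (Fin n) (Fin n) R} (hL : L.IsLowerTriangular) (X : Matrix (Fin n) (Fin n) R)
    (i j : Fin n) : (L * X) i j = L i i * X i j + ∑ k ∈ Finset.Iio i, L i k * X k j := by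
  rw [Matrix.mul_apply, ← Finset.sum_subset (Finset.subset_univ (Finset.Iic i)),
    ← Finset.Iio_insert, Finset.sum_insert (by simp)]
  intro k _ hk
  rw [hL (not_le.1 fun h => hk (Finset.mem_Iic.2 h)), zero_mul]

variable {L : ℝ → Matrix (Fin n) (Fin n) ℂ}

theorem eq_zero_of_hasEntryDeriv_isLowerTriangular (hL : ∀ i j, Continuous fun t => L t i j)
    (hlow : ∀ t, (L t).IsLowerTriangular) {X : ℝ → Matrix (Fin n) (Fin n) ℂ} (h0 : X 0 = 0)
    (hX : ∀ t, 0 ≤ t → HasEntryDeriv X (-(L t * X t)) (Set.Ici 0) t) {t : ℝ} (ht : 0 ≤ t) :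
    X t = 0 := by
  ext i j
  induction i using WellFoundedLT.induction generalizing t with
  | ind i ih =>
    refine eq_zero_of_hasDerivWithinAt (y := fun u => X u i j) (hL i i) (by simp [h0])
      (fun u hu => (hX u hu i j).congr_deriv ?_) ht
    rw [Matrix.neg_apply, mul_apply_of_isLowerTriangular (hlow u), Finset.sum_eq_zero, add_zero]
    intro k hk
    rw [ih k (Finset.mem_Iio.1 hk) hu, Matrix.zero_apply, mul_zero]

/-- The entries of the solution of `W' = -L W`, `W(0) = 1` with a lower triangular `L`, found row
by row. -/
def lowerSolutionEntry (L : ℝ → Matrix (Fin n) (Fin n) ℂ) (i j : Fin n) : ℝ → ℂ :=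
  scalarSolution (fun t => L t i i)
    (fun t => ∑ k : Finset.Iio i, L t i k * lowerSolutionEntry L k j t)
    ((1 : Matrix (Fin n) (Fin n) ℂ) i j)
termination_by i
decreasing_by exact Fin.lt_def.1 (Finset.mem_Iio.1 k.2)

/-- The solution of `W' = -L W`, `W(0) = 1` with a lower triangular `L`. -/
def lowerSolution (L : ℝ → Matrix (Fin n) (Fin n) ℂ) (t : ℝ) : Matrix (Fin n) (Fin n) ℂ :=
  Matrix.of fun i j => lowerSolutionEntry L i j t

theorem lowerSolution_apply (L : ℝ → Matrix (Fin n) (Fin n) ℂ) (i j : Fin n) :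
    (fun t => lowerSolution L t i j) = scalarSolution (fun t => L t i i)
      (fun t => ∑ k ∈ Finset.Iio i, L t i k * lowerSolution L t k j)
      ((1 : Matrix (Fin n) (Fin n) ℂ) i j) := by
  simp only [lowerSolution, Matrix.of_apply]
  rw [lowerSolutionEntry]
  exact congrArg (scalarSolution (fun t => L t i i) · ((1 : Matrix (Fin n) (Fin n) ℂ) i j))
    (funext fun t => Finset.sum_coe_sort (Finset.Iio i) fun k =>
      L t i k * lowerSolutionEntry L k j t)

theorem lowerSolution_zero (L : ℝ → Matrix (Fin n) (Fin n) ℂ) : lowerSolution L 0 = 1 := by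
  ext i j
  exact (congrFun (lowerSolution_apply L i j) 0).trans (scalarSolution_zero _ _ _)

theorem hasDerivAt_lowerSolution (hL : ∀ i j, Continuous fun t => L t i j)
    (hlow : ∀ t, (L t).IsLowerTriangular) (t : ℝ) (i j : Fin n) :
    HasDerivAt (fun u => lowerSolution L u i j) ((-(L t * lowerSolution L t)) i j) t := by
  induction i using WellFoundedLT.induction generalizing t with
  | ind i ih =>
    have hcont : Continuous fun t => ∑ k ∈ Finset.Iio i, L t i k * lowerSolution L t k j :=
      continuous_finsetSum _ fun k hk => (hL i k).mul <| continuous_iff_continuousAt.2 fun t =>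
        (ih k (Finset.mem_Iio.1 hk) t).continuousAt
    have hrow := lowerSolution_apply L i j
    have hderiv := hasDerivAt_scalarSolution (hL i i) hcont
      ((1 : Matrix (Fin n) (Fin n) ℂ) i j) t
    rw [← hrow] at hderiv
    refine hderiv.congr_deriv ?_
    rw [Matrix.neg_apply, mul_apply_of_isLowerTriangular (hlow t), neg_add, sub_eq_add_neg]

theorem isLowerTriangular_lowerSolution (L : ℝ → Matrix (Fin n) (Fin n) ℂ) (t : ℝ) :
    (lowerSolution L t).IsLowerTriangular := by
  intro i j hij
  replace hij : i < j := hij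
  induction i using WellFoundedLT.induction generalizing t with
  | ind i ih =>
    rw [congrFun (lowerSolution_apply L i j) t, scalarSolution_of_forall_eq_zero,
      Matrix.one_apply_ne hij.ne, mul_zero]
    intro u
    refine Finset.sum_eq_zero fun k hk => ?_
    have hki := Finset.mem_Iio.1 hk
    rw [ih k hki u (hki.trans hij), mul_zero]

theorem isPosLower_lowerSolution (hdiag : ∀ t i, (L t i i).im = 0) (t : ℝ) :
    IsPosLower (lowerSolution L t) := by
  refine ⟨isLowerTriangular_lowerSolution L t, fun i => ?_⟩
  have hreal : ∫ u in (0 : ℝ)..t, L u i i = ((∫ u in (0 : ℝ)..t, (L u i i).re : ℝ) : ℂ) := by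
    rw [← intervalIntegral.integral_ofReal]
    exact intervalIntegral.integral_congr fun u _ => Complex.ext rfl (by simp [hdiag])
  rw [congrFun (lowerSolution_apply L i i) t, scalarSolution_of_forall_eq_zero,
    Matrix.one_apply_eq, mul_one, hreal, ← Complex.ofReal_neg, ← Complex.ofReal_exp]
  · exact Complex.zero_lt_real.2 (Real.exp_pos _)
  · intro u
    refine Finset.sum_eq_zero fun k hk => ?_
    have hki : k < i := Finset.mem_Iio.1 hk
    rw [isLowerTriangular_lowerSolution L u hki, mul_zero]

end LowerEquation

/-! ### The flow in terms of a triangular factorization -/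

section Intertwining

variable {n : ℕ}

theorem aeval_mul_of_mul_eq {R A : Type*} [CommSemiring R] [Semiring A] [Algebra R A] {a b x : A}
    (h : a * x = x * b) (p : Polynomial R) :
    Polynomial.aeval a p * x = x * Polynomial.aeval b p := by
  induction p using Polynomial.induction_on' with
  | add p q hp hq => rw [map_add, map_add, add_mul, mul_add, hp, hq]
  | monomial m c =>
    have hpow : SemiconjBy x (b ^ m) (a ^ m) := SemiconjBy.pow_right h.symm m
    simp only [Polynomial.aeval_monomial, ← Algebra.smul_def, smul_mul_assoc, mul_smul_comm,
      hpow.eq]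

theorem aeval_diagonal {m R : Type*} [Fintype m] [DecidableEq m] [CommSemiring R] (z : m → R)
    (p : Polynomial R) :
    Polynomial.aeval (Matrix.diagonal z) p = Matrix.diagonal fun i => p.eval (z i) := by
  rw [← Matrix.diagonalAlgHom_apply (R := R), Polynomial.aeval_algHom_apply,
    Matrix.diagonalAlgHom_apply]
  exact congrArg Matrix.diagonal (funext fun i => by
    rw [Polynomial.aeval_pi_apply₂, Polynomial.coe_aeval_eq_eval])

theorem continuous_projL_apply {X : ℝ → Matrix (Fin n) (Fin n) ℂ} (hX : Continuous X)
    (i j : Fin n) : Continuous fun t => projL (X t) i j := by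
  have hentry : ∀ i j, Continuous fun t => X t i j := hX.matrix_elem
  simp only [projL, projA, Matrix.sub_apply, Matrix.of_apply]
  split_ifs
  · exact (hentry i j).sub (hentry i j)
  · exact (hentry i j).sub (hentry j i).star.neg
  · exact (hentry i j).sub (continuous_const.mul (Complex.continuous_ofReal.comp
      (Complex.continuous_im.comp (hentry i i))))

theorem conjTranspose_mul_self_eq_of_hasEntryDeriv {A U : ℝ → Matrix (Fin n) (Fin n) ℂ}
    (hA : ∀ t, (A t)ᴴ = -A t) (hU : ∀ t, 0 ≤ t → HasEntryDeriv U (A t * U t) (Set.Ici 0) t) {t : ℝ}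
    (ht : 0 ≤ t) : (U t)ᴴ * U t = (U 0)ᴴ * U 0 := by
  refine eq_of_hasEntryDeriv_Ici_zero (X := fun u => (U u)ᴴ * U u) (fun u hu => ?_) ht
  convert (hU u hu).conjTranspose.mul (hU u hu) using 1
  rw [Matrix.conjTranspose_mul, hA]
  noncomm_ring

/-- The diagonal matrix `exp(t p(z_j))`. -/
def expDiag (p : Polynomial ℂ) (z : Fin n → ℂ) (t : ℝ) : Matrix (Fin n) (Fin n) ℂ :=
  Matrix.diagonal fun i => Complex.exp (t * p.eval (z i))

theorem expDiag_zero (p : Polynomial ℂ) (z : Fin n → ℂ) : expDiag p z 0 = 1 := by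
  simp [expDiag]

theorem hasEntryDeriv_expDiag (p : Polynomial ℂ) (z : Fin n → ℂ) (s : Set ℝ) (t : ℝ) :
    HasEntryDeriv (expDiag p z) ((Matrix.diagonal fun i => p.eval (z i)) * expDiag p z t) s t := by
  intro i j
  by_cases hij : i = j
  · subst hij
    have h := ((hasDerivAt_id (t : ℂ)).mul_const (p.eval (z i))).cexp.comp_ofReal
    simp only [expDiag, Matrix.diagonal_mul_diagonal, Matrix.diagonal_apply_eq]
    exact h.hasDerivWithinAt.congr_deriv (by rw [one_mul, id_eq, mul_comm])
  · simp only [expDiag, Matrix.diagonal_mul_diagonal, Matrix.diagonal_apply_ne _ hij]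
    exact hasDerivWithinAt_const _ _ _

/-- The lower triangular factor `projL (G(C(t)))`, `G(B) = B f'(B)`, of the Lax equation. It is
constant at negative times, where a trajectory is unconstrained, so as to be continuous. -/
def laxFactor (f : Polynomial ℂ) (C : ℝ → Matrix (Fin n) (Fin n) ℂ) (t : ℝ) :
    Matrix (Fin n) (Fin n) ℂ :=
  projL (Polynomial.aeval (C (max t 0)) (eulerPoly f))

/-- The lower triangular `W(t)` that intertwines `C(0)` and `C(t)` along a trajectory. -/
def intertwiner (f : Polynomial ℂ) (C : ℝ → Matrix (Fin n) (Fin n) ℂ) :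
    ℝ → Matrix (Fin n) (Fin n) ℂ :=
  lowerSolution (laxFactor f C)

variable {f : Polynomial ℂ} {C : ℝ → Matrix (Fin n) (Fin n) ℂ}

theorem laxFactor_of_nonneg {t : ℝ} (ht : 0 ≤ t) :
    laxFactor f C t = projL (Polynomial.aeval (C t) (eulerPoly f)) := by
  rw [laxFactor, max_eq_left ht]

theorem isLowerTriangular_laxFactor (t : ℝ) : (laxFactor f C t).IsLowerTriangular :=
  fun _ _ hij => projL_upper _ hij

theorem isPosLower_intertwiner (t : ℝ) : IsPosLower (intertwiner f C t) :=
  isPosLower_lowerSolution (fun _ => projL_diag _) t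

namespace IsTrajectory

theorem continuous_laxFactor_apply (hC : IsTrajectory (hamiltonian f) C) (i j : Fin n) :
    Continuous fun t => laxFactor f C t i j := by
  have hcont : Continuous fun t => C (max t 0) := by
    refine continuous_matrix fun i j => ?_
    have hentry : ContinuousOn (fun t => C t i j) (Set.Ici 0) := fun t ht =>
      (hC.hasEntryDeriv ht i j).continuousWithinAt
    exact hentry.comp_continuous (continuous_id.max continuous_const) fun t => le_max_right t 0
  exact continuous_projL_apply ((Polynomial.continuous_aeval _).comp hcont) i j

theorem hasEntryDeriv_intertwiner (hC : IsTrajectory (hamiltonian f) C) (t : ℝ) :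
    HasEntryDeriv (intertwiner f C) (-(laxFactor f C t * intertwiner f C t)) (Set.Ici 0) t :=
  fun i j => (hasDerivAt_lowerSolution hC.continuous_laxFactor_apply isLowerTriangular_laxFactor
    t i j).hasDerivWithinAt

theorem mul_intertwiner (hC : IsTrajectory (hamiltonian f) C) {t : ℝ} (ht : 0 ≤ t) :
    C t * intertwiner f C t = intertwiner f C t * C 0 := by
  refine sub_eq_zero.1 (eq_zero_of_hasEntryDeriv_isLowerTriangular hC.continuous_laxFactor_apply
    isLowerTriangular_laxFactor (X := fun u => C u * intertwiner f C u - intertwiner f C u * C 0)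
    (by simp [intertwiner, lowerSolution_zero]) (fun u hu => ?_) ht)
  have hW := hC.hasEntryDeriv_intertwiner u
  convert ((hC.hasEntryDeriv hu).mul hW).sub (hW.mul (hasEntryDeriv_const (C 0) _ _)) using 1
  rw [← laxFactor_of_nonneg hu]
  noncomm_ring

variable {Q : Matrix (Fin n) (Fin n) ℂ} {z : Fin n → ℂ}

theorem hasEntryDeriv_intertwiner_mul (hC : IsTrajectory (hamiltonian f) C)
    (hCQ : C 0 * Q = Q * Matrix.diagonal z) {t : ℝ} (ht : 0 ≤ t) :
    HasEntryDeriv (fun t => intertwiner f C t * (Q * expDiag (eulerPoly f) z t))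
      (projA (Polynomial.aeval (C t) (eulerPoly f)) *
        (intertwiner f C t * (Q * expDiag (eulerPoly f) z t))) (Set.Ici 0) t := by
  set G := Polynomial.aeval (C t) (eulerPoly f) with hG
  set W := intertwiner f C
  have hGWQ : G * (W t * Q) = W t * Q * Matrix.diagonal fun i => (eulerPoly f).eval (z i) := by
    rw [← aeval_diagonal]
    refine aeval_mul_of_mul_eq ?_ _
    rw [← mul_assoc, hC.mul_intertwiner ht, mul_assoc, hCQ, mul_assoc]
  have hprojA : projA G = G - laxFactor f C t := by
    rw [laxFactor_of_nonneg ht, ← hG, projL, sub_sub_cancel]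
  convert (hC.hasEntryDeriv_intertwiner t).mul ((hasEntryDeriv_const Q _ _).mul
    (hasEntryDeriv_expDiag (eulerPoly f) z _ _)) using 1
  calc projA G * (W t * (Q * expDiag (eulerPoly f) z t))
      = G * (W t * Q) * expDiag (eulerPoly f) z t
          - laxFactor f C t * W t * (Q * expDiag (eulerPoly f) z t) := by
        rw [hprojA]
        noncomm_ring
    _ = _ := by
        rw [hGWQ]
        noncomm_ring

theorem intertwiner_mul_mem_unitaryGroup (hC : IsTrajectory (hamiltonian f) C)
    (hQ : Q ∈ Matrix.unitaryGroup (Fin n) ℂ) (hCQ : C 0 * Q = Q * Matrix.diagonal z) {t : ℝ}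
    (ht : 0 ≤ t) :
    intertwiner f C t * (Q * expDiag (eulerPoly f) z t) ∈ Matrix.unitaryGroup (Fin n) ℂ := by
  refine Matrix.mem_unitaryGroup_iff'.2 ((conjTranspose_mul_self_eq_of_hasEntryDeriv
    (fun u => projA_conjTranspose (Polynomial.aeval (C u) (eulerPoly f)))
    (fun u hu => hC.hasEntryDeriv_intertwiner_mul hCQ hu) ht).trans ?_)
  rw [expDiag_zero, intertwiner, lowerSolution_zero, one_mul, mul_one]
  exact hQ.1

end IsTrajectory

end Intertwining

section CmvAlongFlow

variable {n : ℕ}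

theorem diagonal_mem_unitaryGroup {m 𝕜 : Type*} [Fintype m] [DecidableEq m] [RCLike 𝕜] {z : m → 𝕜}
    (hz : ∀ i, ‖z i‖ = 1) : Matrix.diagonal z ∈ Matrix.unitaryGroup m 𝕜 := by
  rw [Matrix.mem_unitaryGroup_iff, Matrix.star_eq_conjTranspose, Matrix.diagonal_conjTranspose,
    Matrix.diagonal_mul_diagonal, ← Matrix.diagonal_one]
  exact congrArg Matrix.diagonal (funext fun i => by
    rw [Pi.star_apply, RCLike.star_def, RCLike.mul_conj, hz, RCLike.ofReal_one, one_pow])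

theorem eq_mul_diagonal_mul_star {m R : Type*} [Fintype m] [DecidableEq m] [CommRing R]
    [StarRing R] {B X : Matrix m m R} {z : m → R} (hX : X ∈ Matrix.unitaryGroup m R)
    (hBX : B * X = X * Matrix.diagonal z) : B = X * Matrix.diagonal z * star X := by
  rw [← hBX, mul_assoc, Matrix.mem_unitaryGroup_iff.1 hX, mul_one]

theorem mem_unitaryGroup_of_mul_eq_mul_diagonal {m 𝕜 : Type*} [Fintype m] [DecidableEq m]
    [RCLike 𝕜] {B X : Matrix m m 𝕜} {z : m → 𝕜} (hX : X ∈ Matrix.unitaryGroup m 𝕜)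
    (hz : ∀ i, ‖z i‖ = 1) (hBX : B * X = X * Matrix.diagonal z) :
    B ∈ Matrix.unitaryGroup m 𝕜 := by
  rw [eq_mul_diagonal_mul_star hX hBX]
  exact mul_mem (mul_mem hX (diagonal_mem_unitaryGroup hz)) (Unitary.star_mem hX)

theorem star_mul_eq_mul_star_of_mul_eq {A B W : Matrix (Fin n) (Fin n) ℂ}
    (hA : A ∈ Matrix.unitaryGroup (Fin n) ℂ) (hB : B ∈ Matrix.unitaryGroup (Fin n) ℂ)
    (h : B * W = W * A) : star B * W = W * star A := by
  calc star B * W = star B * (W * A) * star A := by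
        rw [mul_assoc, mul_assoc, Matrix.mem_unitaryGroup_iff.1 hA, mul_one]
    _ = W * star A := by rw [← h, ← mul_assoc, Matrix.mem_unitaryGroup_iff'.1 hB, one_mul]

theorem IsStaircase.map_star {r : Fin n → ℕ} {B : Matrix (Fin n) (Fin n) ℂ}
    (hB : IsStaircase r B) : IsStaircase r (B.map star) where
  apply_eq_zero h := by rw [Matrix.map_apply, hB.apply_eq_zero h, star_zero]
  corner_pos h hcorner := star_pos_iff.2 (hB.corner_pos h hcorner)

theorem exists_cmv_of_mul_posLower_eq [NeZero n] {α₀ : Fin n → ℂ} (hα₀ : IsVerblunsky α₀)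
    {B W : Matrix (Fin n) (Fin n) ℂ} (hW : IsPosLower W)
    (hB : B ∈ Matrix.unitaryGroup (Fin n) ℂ) (hBW : B * W = W * cmv α₀) :
    ∃ α, IsVerblunsky α ∧ B = cmv α := by
  obtain ⟨m, rfl⟩ := Nat.exists_eq_succ_of_ne_zero (NeZero.ne n)
  have hstar : IsStaircase (reach 1) (star B) :=
    (isStaircase_cmv_transpose hα₀).map_star.of_mul_posLower_eq (reach_monotone 1) hW
      (star_mul_eq_mul_star_of_mul_eq (cmv_mem_unitaryGroup hα₀) hB hBW)
  refine exists_eq_cmv hB ((isStaircase_cmv hα₀).of_mul_posLower_eq (reach_monotone 0) hW hBW) ?_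
  convert hstar.map_star using 1
  ext i j
  simp

end CmvAlongFlow

/-! ### Minors of the eigenvector matrix -/

section Minors

variable {n k : ℕ}

theorem submatrix_castLE_mul_of_isLowerTriangular {R : Type*} [NonUnitalNonAssocSemiring R]
    (hk : k ≤ n) {S : Matrix (Fin n) (Fin n) R} (hS : S.IsLowerTriangular)
    (X : Matrix (Fin n) (Fin n) R) (e : Fin k → Fin n) :
    (S * X).submatrix (Fin.castLE hk) e =
      S.submatrix (Fin.castLE hk) (Fin.castLE hk) * X.submatrix (Fin.castLE hk) e := by
  ext i j
  refine (Fintype.sum_of_injective _ (Fin.castLE_injective hk) _ _ (fun m hm => ?_)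
    fun _ => rfl).symm
  have hkm : k ≤ m.val := by
    by_contra! hlt
    exact hm ⟨⟨m.val, hlt⟩, rfl⟩
  have hlt : Fin.castLE hk i < m := Fin.lt_def.2 (i.isLt.trans_le hkm)
  exact mul_eq_zero_of_left (hS hlt) _

theorem IsPosLower.det_submatrix_castLE_ne_zero {W : Matrix (Fin n) (Fin n) ℂ} (hW : IsPosLower W)
    (hk : k ≤ n) : (W.submatrix (Fin.castLE hk) (Fin.castLE hk)).det ≠ 0 := by
  have hlead : IsPosLower (W.submatrix (Fin.castLE hk) (Fin.castLE hk)) :=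
    ⟨fun _ _ hij => hW.isLowerTriangular (Fin.strictMono_castLE hk hij),
      fun i => hW.diag_pos (Fin.castLE hk i)⟩
  exact hlead.isUnit_det.ne_zero

theorem vander_map_orderEmbedding (z : Fin n → ℂ) (e : Fin k ↪o Fin n) :
    vander z (Finset.univ.map e.toEmbedding) = (Matrix.vandermonde fun i => z (e i)).det := by
  rw [Matrix.det_vandermonde, vander, Finset.prod_filter, Finset.prod_product, Finset.prod_map]
  refine Finset.prod_congr rfl fun i _ => ?_
  rw [Finset.prod_map, ← Finset.filter_lt_eq_Ioi, Finset.prod_filter]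
  simp only [RelEmbedding.coe_toEmbedding, OrderEmbedding.lt_iff_lt]

theorem sum_orderEmbedding {I M : Type*} [LinearOrder I] [Fintype I] [AddCommMonoid M]
    (H : Finset I → M) :
    ∑ e : Fin k ↪o I, H (Finset.univ.map e.toEmbedding) =
      ∑ s ∈ Finset.univ.powersetCard k, H s := by
  refine (Set.powersetCard.ofFinEmbEquiv.sum_comp fun s : Set.powersetCard I k => H s).trans ?_
  exact (Finset.sum_subtype _ (by simp [Set.powersetCard.mem_iff]) H).symm

end Minors

section Zigzag

variable {n k : ℕ}

/-- The sequence `1, w⋆, w, w⋆², w², …`. On the unit circle these are the functions whose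
orthonormalization is the basis in which a CMV matrix represents multiplication by `w`. -/
def zigzag {M : Type*} [Monoid M] [Star M] (p : ℕ) (w : M) : M :=
  if p % 2 = 0 then w ^ (p / 2) else star w ^ ((p + 1) / 2)

theorem zigzag_two_mul {M : Type*} [Monoid M] [Star M] (m : ℕ) (w : M) :
    zigzag (2 * m) w = w ^ m := by
  simp [zigzag]

theorem zigzag_two_mul_add_one {M : Type*} [Monoid M] [Star M] (m : ℕ) (w : M) :
    zigzag (2 * m + 1) w = star w ^ (m + 1) := by
  rw [zigzag, if_neg (by omega)]
  congr 1
  omega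

/-- The position, in increasing order of the exponents, of the `p`-th term of the zigzag sequence
among its first `k` terms. -/
def zigzagRank (p : Fin k) : Fin k :=
  ⟨if p.val % 2 = 0 then k / 2 + p.val / 2 else k / 2 - (p.val + 1) / 2, by
    have := p.isLt
    split_ifs <;> omega⟩

theorem zigzagRank_injective : Function.Injective (zigzagRank (k := k)) := fun p q h => by
  have h' := congrArg Fin.val h
  simp only [zigzagRank] at h'
  have := p.isLt
  have := q.isLt
  apply Fin.ext
  split_ifs at h' <;> omega

theorem zigzag_eq_conj_pow_mul_pow {w : ℂ} (hw : ‖w‖ = 1) (p : Fin k) :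
    zigzag p.val w = conj w ^ (k / 2) * w ^ (zigzagRank p).val := by
  have hcancel : ∀ m, conj w ^ m * w ^ m = 1 := fun m => by
    rw [← mul_pow, Complex.conj_mul', hw, Complex.ofReal_one, one_pow, one_pow]
  simp only [zigzag, zigzagRank]
  split_ifs with h
  · rw [pow_add, ← mul_assoc, hcancel, one_mul]
  · have hk : k / 2 = (p.val + 1) / 2 + (k / 2 - (p.val + 1) / 2) := by omega
    conv_rhs => rw [hk, pow_add, mul_assoc, Nat.add_sub_cancel_left, hcancel, mul_one]
    rfl

theorem norm_det_zigzag {w : Fin k → ℂ} (hw : ∀ i, ‖w i‖ = 1) :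
    ‖(Matrix.of fun p i : Fin k => zigzag p.val (w i)).det‖ = ‖(Matrix.vandermonde w).det‖ := by
  let σ : Equiv.Perm (Fin k) :=
    Equiv.ofBijective zigzagRank (Finite.injective_iff_bijective.1 zigzagRank_injective)
  have hperm : (Matrix.of fun p i : Fin k => zigzag p.val (w i)) =
      Matrix.of fun p i => conj (w i) ^ (k / 2) * (Matrix.vandermonde w)ᵀ.submatrix σ id p i := by
    ext p i
    exact zigzag_eq_conj_pow_mul_pow (hw i) p
  rw [hperm, Matrix.det_mul_row, Matrix.det_permute, Matrix.det_transpose, norm_mul, norm_mul,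
    norm_prod, Finset.prod_eq_one fun i _ => by rw [norm_pow, RCLike.norm_conj, hw, one_pow]]
  rcases Int.units_eq_one_or (Equiv.Perm.sign σ) with h | h <;> simp [h]

theorem zigzag_diagonal {m R : Type*} [Fintype m] [DecidableEq m] [CommSemiring R] [StarRing R]
    (p : ℕ) (z : m → R) :
    zigzag p (Matrix.diagonal z) = Matrix.diagonal fun i => zigzag p (z i) := by
  obtain ⟨m, rfl | rfl⟩ := Nat.even_or_odd' p
  · simp only [zigzag_two_mul]
    exact Matrix.diagonal_pow z _
  · simp only [zigzag_two_mul_add_one]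
    rw [Matrix.star_eq_conjTranspose, Matrix.diagonal_conjTranspose, Matrix.diagonal_pow]
    rfl

theorem zigzag_mul_eq_mul_zigzag {A B W : Matrix (Fin n) (Fin n) ℂ}
    (hA : A ∈ Matrix.unitaryGroup (Fin n) ℂ) (hB : B ∈ Matrix.unitaryGroup (Fin n) ℂ)
    (h : B * W = W * A) (p : ℕ) : zigzag p B * W = W * zigzag p A := by
  have hstar := star_mul_eq_mul_star_of_mul_eq hA hB h
  obtain ⟨m, rfl | rfl⟩ := Nat.even_or_odd' p
  · simp only [zigzag_two_mul]
    exact (SemiconjBy.pow_right h.symm _).eq.symm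
  · simp only [zigzag_two_mul_add_one]
    exact (SemiconjBy.pow_right hstar.symm _).eq.symm

/-- Vectors whose last nonzero entry is a positive one in position `c`; positions outside of the
range of the indices are allowed and impose no condition. -/
structure LeadsAt (x : Fin n → ℂ) (c : ℕ) : Prop where
  apply_eq_zero : ∀ {j : Fin n}, c < j → x j = 0
  apply_pos : ∀ {j : Fin n}, j.val = c → 0 < x j

theorem LeadsAt.vecMul {p c : ℕ} {x : Fin n → ℂ} {B : Matrix (Fin n) (Fin n) ℂ}
    (hx : LeadsAt x c) (hB : IsStaircase (reach p) B) (hc : (c + p) % 2 = 0) :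
    LeadsAt (x ᵥ* B) (c + 2) where
  apply_eq_zero {j} hj := by
    rw [Matrix.vecMul, dotProduct]
    refine Finset.sum_eq_zero fun m _ => ?_
    rcases lt_or_ge c m.val with h | h
    · rw [hx.apply_eq_zero h, zero_mul]
    · have hreach : reach p m < j := by
        simp only [reach]
        omega
      rw [hB.apply_eq_zero hreach, mul_zero]
  apply_pos {j} hj := by
    let i : Fin n := ⟨c, by omega⟩
    have hij : reach p i = j := by
      simp only [reach, i]
      omega
    have hreach : ∀ m < i, reach p m < j := fun m hm => by
      have hmc : m.val < c := hm
      simp only [reach]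
      omega
    rw [Matrix.vecMul, dotProduct, Finset.sum_eq_single i]
    · exact mul_pos (hx.apply_pos (j := i) rfl) (hB.corner_pos hij hreach)
    · intro m _ hm
      rcases lt_or_gt_of_ne hm with h | h
      · rw [hB.apply_eq_zero (hreach m h), mul_zero]
      · rw [hx.apply_eq_zero h, zero_mul]
    · exact fun h => absurd (Finset.mem_univ i) h

variable [NeZero n]

theorem IsStaircase.leadsAt_pow {B : Matrix (Fin n) (Fin n) ℂ} (hB : IsStaircase (reach 0) B) :
    ∀ m, LeadsAt ((B ^ m) 0) (2 * m)
  | 0 => by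
    rw [pow_zero]
    refine ⟨fun {j} hj => Matrix.one_apply_ne (Fin.pos_iff_ne_zero.1 hj).symm, fun {j} hj => ?_⟩
    obtain rfl : j = 0 := Fin.ext hj
    rw [Matrix.one_apply_eq]
    exact one_pos
  | m + 1 => by
    rw [pow_succ, Matrix.mul_apply_eq_vecMul]
    exact (hB.leadsAt_pow m).vecMul hB (by omega)

theorem IsStaircase.leadsAt_pow_succ {B : Matrix (Fin n) (Fin n) ℂ}
    (hB : IsStaircase (reach 1) B) : ∀ m, LeadsAt ((B ^ (m + 1)) 0) (2 * m + 1)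
  | 0 => by
    rw [zero_add, pow_one]
    exact ⟨fun hj => hB.apply_eq_zero hj, fun hj => hB.corner_pos hj.symm fun m hm =>
      absurd hm (Fin.zero_le m).not_gt⟩
  | m + 1 => by
    rw [pow_succ, Matrix.mul_apply_eq_vecMul]
    exact (hB.leadsAt_pow_succ m).vecMul hB (by omega)

theorem isPosLower_zigzag_cmv {α : Fin n → ℂ} (hα : IsVerblunsky α) :
    IsPosLower (Matrix.of fun p : Fin n => zigzag p.val (cmv α) 0) := by
  have hleads : ∀ p : Fin n, LeadsAt (zigzag p.val (cmv α) 0) p := fun p => by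
    obtain ⟨m, hp | hp⟩ := Nat.even_or_odd' p.val
    · rw [hp, zigzag_two_mul]
      exact (isStaircase_cmv hα).leadsAt_pow m
    · rw [hp, zigzag_two_mul_add_one]
      exact (isStaircase_cmv_transpose hα).map_star.leadsAt_pow_succ m
  exact ⟨fun p j hpj => (hleads p).apply_eq_zero hpj, fun p => (hleads p).apply_pos rfl⟩

end Zigzag

section Eigenvectors

variable {n k : ℕ} {Q : Matrix (Fin n) (Fin n) ℂ} {z : Fin n → ℂ}

theorem norm_eq_one_of_diagonal_mem_unitaryGroup {m 𝕜 : Type*} [Fintype m] [DecidableEq m]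
    [RCLike 𝕜] {z : m → 𝕜} (hz : Matrix.diagonal z ∈ Matrix.unitaryGroup m 𝕜) (i : m) :
    ‖z i‖ = 1 := by
  have h := Matrix.mem_unitaryGroup_iff.1 hz
  rw [Matrix.star_eq_conjTranspose, Matrix.diagonal_conjTranspose, Matrix.diagonal_mul_diagonal]
    at h
  have hi := congrFun (congrFun h i) i
  rw [Matrix.diagonal_apply_eq, Matrix.one_apply_eq, Pi.star_apply, RCLike.star_def,
    RCLike.mul_conj] at hi
  exact (pow_eq_one_iff_of_nonneg (norm_nonneg _) two_ne_zero).1 (by exact_mod_cast hi)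

theorem diagonal_mem_unitaryGroup_of_mul_eq {m 𝕜 : Type*} [Fintype m] [DecidableEq m] [RCLike 𝕜]
    {C Q : Matrix m m 𝕜} {z : m → 𝕜} (hC : C ∈ Matrix.unitaryGroup m 𝕜)
    (hQ : Q ∈ Matrix.unitaryGroup m 𝕜) (hCQ : C * Q = Q * Matrix.diagonal z) :
    Matrix.diagonal z ∈ Matrix.unitaryGroup m 𝕜 := by
  have hD : Matrix.diagonal z = star Q * (C * Q) := by
    rw [hCQ, ← mul_assoc, Matrix.mem_unitaryGroup_iff'.1 hQ, one_mul]
  rw [hD]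
  exact mul_mem (Unitary.star_mem hQ) (mul_mem hC hQ)

variable [NeZero n] {α : Fin n → ℂ}

theorem zigzag_cmv_mul_eigenvectors (hα : IsVerblunsky α)
    (hQ : Q ∈ Matrix.unitaryGroup (Fin n) ℂ) (hCQ : cmv α * Q = Q * Matrix.diagonal z) :
    Matrix.of (fun p : Fin n => zigzag p.val (cmv α) 0) * Q =
      Matrix.of fun p i : Fin n => Q 0 i * zigzag p.val (z i) := by
  have hC := cmv_mem_unitaryGroup hα
  ext p i
  have hrow := zigzag_mul_eq_mul_zigzag (diagonal_mem_unitaryGroup_of_mul_eq hC hQ hCQ) hC hCQ p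
  rw [zigzag_diagonal] at hrow
  exact (congrFun (congrFun hrow 0) i).trans (Matrix.mul_diagonal _ _ _ _)

theorem exists_mul_norm_minor_eq (hα : IsVerblunsky α) (hQ : Q ∈ Matrix.unitaryGroup (Fin n) ℂ)
    (hCQ : cmv α * Q = Q * Matrix.diagonal z) (hk : k ≤ n) :
    ∃ c : ℝ, 0 < c ∧ ∀ e : Fin k → Fin n, c * ‖(Q.submatrix (Fin.castLE hk) e).det‖ =
      (∏ i, ‖Q 0 (e i)‖) * ‖(Matrix.vandermonde fun i => z (e i)).det‖ := by
  have hS := isPosLower_zigzag_cmv hα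
  have hz := norm_eq_one_of_diagonal_mem_unitaryGroup
    (diagonal_mem_unitaryGroup_of_mul_eq (cmv_mem_unitaryGroup hα) hQ hCQ)
  refine ⟨_, norm_pos_iff.2 (hS.det_submatrix_castLE_ne_zero hk), fun e => ?_⟩
  rw [← norm_mul, ← Matrix.det_mul,
    ← submatrix_castLE_mul_of_isLowerTriangular hk hS.isLowerTriangular,
    zigzag_cmv_mul_eigenvectors hα hQ hCQ, ← norm_det_zigzag fun i => hz (e i), ← norm_prod,
    ← norm_mul, ← Matrix.det_mul_row]
  rfl

theorem prod_norm_mul_norm_det_vandermonde_ne_zero (hα : IsVerblunsky α)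
    (hQ : Q ∈ Matrix.unitaryGroup (Fin n) ℂ) (hCQ : cmv α * Q = Q * Matrix.diagonal z) :
    (∏ i, ‖Q 0 i‖) * ‖(Matrix.vandermonde z).det‖ ≠ 0 := by
  obtain ⟨c, hc, hminor⟩ := exists_mul_norm_minor_eq hα hQ hCQ le_rfl
  have hdet : Q.det ≠ 0 := (Matrix.isUnit_det_of_left_inverse hQ.1).ne_zero
  exact hminor id ▸ mul_ne_zero hc.ne' (norm_ne_zero_iff.2 hdet)

theorem eigenvector_zero_ne_zero (hα : IsVerblunsky α) (hQ : Q ∈ Matrix.unitaryGroup (Fin n) ℂ)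
    (hCQ : cmv α * Q = Q * Matrix.diagonal z) (i : Fin n) : Q 0 i ≠ 0 :=
  norm_ne_zero_iff.1 <| Finset.prod_ne_zero_iff.1 (left_ne_zero_of_mul
    (prod_norm_mul_norm_det_vandermonde_ne_zero hα hQ hCQ)) i (Finset.mem_univ i)

theorem eigenvalues_injective (hα : IsVerblunsky α) (hQ : Q ∈ Matrix.unitaryGroup (Fin n) ℂ)
    (hCQ : cmv α * Q = Q * Matrix.diagonal z) : Function.Injective z :=
  Matrix.det_vandermonde_ne_zero_iff.1 <| norm_ne_zero_iff.1 <| right_ne_zero_of_mul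
    (prod_norm_mul_norm_det_vandermonde_ne_zero hα hQ hCQ)

end Eigenvectors

section SpectralMass

variable {n : ℕ} {C Q : Matrix (Fin n) (Fin n) ℂ} {z : Fin n → ℂ}

theorem mulVec_col_of_mul_eq_mul_diagonal {m R : Type*} [Fintype m] [DecidableEq m]
    [CommSemiring R] {C Q : Matrix m m R} {z : m → R} (hCQ : C * Q = Q * Matrix.diagonal z)
    (j : m) : C *ᵥ Q.col j = z j • Q.col j := by
  rw [← Matrix.mulVec_single_one, Matrix.mulVec_mulVec, hCQ, ← Matrix.mulVec_mulVec,
    Matrix.diagonal_mulVec_single, mul_one, ← Matrix.mulVec_smul, ← Pi.single_smul, smul_eq_mul,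
    mul_one]

theorem eq_smul_col_of_mulVec_eq_smul (hQ : Q ∈ Matrix.unitaryGroup (Fin n) ℂ)
    (hCQ : C * Q = Q * Matrix.diagonal z) (hz : Function.Injective z) {j : Fin n} {v : Fin n → ℂ}
    (hv : C *ᵥ v = z j • v) : v = (star Q *ᵥ v) j • Q.col j := by
  obtain ⟨y, hy⟩ : ∃ y, y = star Q *ᵥ v := ⟨_, rfl⟩
  have hvy : v = Q *ᵥ y := by
    rw [hy, Matrix.mulVec_mulVec, Matrix.mem_unitaryGroup_iff.1 hQ, Matrix.one_mulVec]
  have hdiag : Matrix.diagonal z *ᵥ y = z j • y := by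
    calc Matrix.diagonal z *ᵥ y = star Q *ᵥ ((Q * Matrix.diagonal z) *ᵥ y) := by
          rw [Matrix.mulVec_mulVec, ← mul_assoc, Matrix.mem_unitaryGroup_iff'.1 hQ, one_mul]
      _ = star Q *ᵥ (C *ᵥ v) := by rw [← hCQ, ← Matrix.mulVec_mulVec, ← hvy]
      _ = z j • y := by rw [hv, Matrix.mulVec_smul, ← hy]
  have hzero : ∀ i, i ≠ j → y i = 0 := fun i hi => by
    have hi' := congrFun hdiag i
    rw [Matrix.mulVec_diagonal, Pi.smul_apply, smul_eq_mul] at hi'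
    by_contra hne
    exact hi (hz (mul_right_cancel₀ hne hi'))
  have hsingle : y = y j • Pi.single j 1 := by
    ext i
    rcases eq_or_ne i j with rfl | hi
    · simp
    · simp [hzero i hi, hi]
  calc v = Q *ᵥ (y j • Pi.single j 1) := by rw [← hsingle, hvy]
    _ = y j • Q.col j := by rw [Matrix.mulVec_smul, Matrix.mulVec_single_one]
    _ = (star Q *ᵥ v) j • Q.col j := by rw [← hy]

theorem eigenspace_toEuclideanLin (hQ : Q ∈ Matrix.unitaryGroup (Fin n) ℂ)
    (hCQ : C * Q = Q * Matrix.diagonal z) (hz : Function.Injective z) (j : Fin n) :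
    Module.End.eigenspace (Matrix.toEuclideanLin C) (z j) =
      Submodule.span ℂ {WithLp.toLp 2 (Q.col j)} := by
  ext v
  rw [Module.End.mem_eigenspace_iff, Submodule.mem_span_singleton]
  constructor
  · intro hv
    exact ⟨_, congrArg (WithLp.toLp 2)
      (eq_smul_col_of_mulVec_eq_smul hQ hCQ hz (congrArg WithLp.ofLp hv)).symm⟩
  · rintro ⟨c, rfl⟩
    rw [map_smul, smul_comm]
    exact congrArg (fun u => c • WithLp.toLp 2 u) (mulVec_col_of_mul_eq_mul_diagonal hCQ j)

theorem norm_toLp_col (hQ : Q ∈ Matrix.unitaryGroup (Fin n) ℂ) (j : Fin n) :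
    ‖WithLp.toLp 2 (Q.col j)‖ = 1 := by
  rw [← pow_eq_one_iff_of_nonneg (norm_nonneg _) two_ne_zero, EuclideanSpace.norm_sq_eq]
  exact sum_norm_apply_sq_eq_one (Matrix.transpose_mem_unitaryGroup_iff.2 hQ) j

theorem spectralMass_eq [NeZero n] (hQ : Q ∈ Matrix.unitaryGroup (Fin n) ℂ)
    (hCQ : C * Q = Q * Matrix.diagonal z) (hz : Function.Injective z) (j : Fin n) :
    spectralMass C (z j) = ‖Q 0 j‖ ^ 2 := by
  have hq := norm_toLp_col hQ j
  simp only [spectralMass, eigenspace_toEuclideanLin hQ hCQ hz]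
  rw [Submodule.starProjection_unit_singleton ℂ hq, norm_smul, hq, mul_one,
    EuclideanSpace.inner_single_right]
  simp

end SpectralMass

/-! ### Averages with exponential weights -/

section ExpAverage

variable {ι E : Type*} [NormedAddCommGroup E] [NormedSpace ℝ E] {P : Finset ι} {w ℓ : ι → ℝ}

theorem tendsto_centerMass {α : Type*} {F : Filter α} {W : α → ι → ℝ}
    (hW : ∀ i ∈ P, Tendsto (fun t => W t i) F (𝓝 (w i))) (hw : ∑ i ∈ P, w i ≠ 0) (v : ι → E) :
    Tendsto (fun t => P.centerMass (W t) v) F (𝓝 (P.centerMass w v)) :=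
  ((tendsto_finsetSum _ hW).inv₀ hw).smul
    (tendsto_finsetSum _ fun i hi => (hW i hi).smul_const (v i))

/-- The average of `v` over `P` with the weights `w i * exp (t * ℓ i)`. -/
def expAverage (P : Finset ι) (w ℓ : ι → ℝ) (v : ι → E) (t : ℝ) : E :=
  P.centerMass (fun i => w i * Real.exp (t * ℓ i)) v

theorem expAverage_sub_const (P : Finset ι) (w ℓ : ι → ℝ) (M : ℝ) (v : ι → E) (t : ℝ) :
    expAverage P w (fun i => ℓ i - M) v t = expAverage P w ℓ v t := by
  have hscale : (fun i => w i * Real.exp (t * (ℓ i - M))) =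
      Real.exp (-(t * M)) • fun i => w i * Real.exp (t * ℓ i) := by
    ext i
    rw [mul_sub, sub_eq_neg_add, Real.exp_add]
    exact mul_left_comm _ _ _
  rw [expAverage, hscale]
  exact Finset.centerMass_smul_left P v (Real.exp_ne_zero _)

theorem tendsto_exp_mul_of_nonpos {c : ℝ} (hc : c ≤ 0) :
    Tendsto (fun t : ℝ => Real.exp (t * c)) atTop (𝓝 (if c = 0 then 1 else 0)) := by
  rcases hc.eq_or_lt with rfl | hc
  · simp
  · rw [if_neg hc.ne]
    exact Real.tendsto_exp_atBot.comp (tendsto_id.atTop_mul_const_of_neg hc)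

theorem tendsto_expAverage {M : ℝ} (hw : ∀ i ∈ P, 0 < w i) (hℓ : ∀ i ∈ P, ℓ i ≤ M)
    (hM : ∃ i ∈ P, ℓ i = M) (v : ι → E) :
    Tendsto (expAverage P w ℓ v) atTop (𝓝 ({i ∈ P | ℓ i = M}.centerMass w v)) := by
  let w₀ : ι → ℝ := fun i => w i * if ℓ i - M = 0 then 1 else 0
  have hw₀ : ∀ i, ℓ i = M → w₀ i = w i := fun i hi => by simp [w₀, hi]
  have hweights : ∀ i ∈ P, Tendsto (fun t => w i * Real.exp (t * (ℓ i - M))) atTop (𝓝 (w₀ i)) :=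
    fun i hi => (tendsto_exp_mul_of_nonpos (sub_nonpos.2 (hℓ i hi))).const_mul (w i)
  have hsum : 0 < ∑ i ∈ P, w₀ i := by
    obtain ⟨i, hi, hiM⟩ := hM
    refine Finset.sum_pos' (fun j hj => mul_nonneg (hw j hj).le (by split_ifs <;> simp))
      ⟨i, hi, ?_⟩
    rw [hw₀ i hiM]
    exact hw i hi
  have hlimit : P.centerMass w₀ v = {i ∈ P | ℓ i = M}.centerMass w v := by
    rw [← Finset.centerMass_subset v (Finset.filter_subset (fun i => ℓ i = M) P)
      fun i hi hiM => ?_]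
    · exact Finset.centerMass_congr_weights fun i hi => hw₀ i (Finset.mem_filter.1 hi).2
    · exact mul_eq_zero_of_right _ (if_neg (sub_ne_zero.2 fun h =>
        hiM (Finset.mem_filter.2 ⟨hi, h⟩)))
  exact hlimit ▸ (tendsto_centerMass hweights hsum.ne' v).congr fun t =>
    expAverage_sub_const P w ℓ M v t

theorem isBigO_exp_mul {c γ : ℝ} (hc : c ≤ -γ) :
    (fun t : ℝ => Real.exp (t * c)) =O[atTop] fun t => Real.exp (-γ * t) := by
  refine IsBigO.of_bound 1 ((eventually_ge_atTop 0).mono fun t ht => ?_)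
  rw [Real.norm_of_nonneg (Real.exp_nonneg _), Real.norm_of_nonneg (Real.exp_nonneg _), one_mul,
    Real.exp_le_exp, mul_comm]
  exact mul_le_mul_of_nonneg_right hc ht

theorem isBigO_sum_exp_smul {γ : ℝ} (hℓ : ∀ i ∈ P, ℓ i ≤ -γ) (w : ι → ℝ) (u : ι → E) :
    (fun t : ℝ => ∑ i ∈ P, (w i * Real.exp (t * ℓ i)) • u i) =O[atTop]
      fun t => Real.exp (-γ * t) := by
  refine IsBigO.fun_sum fun i hi => ?_
  simp only [mul_smul, smul_comm (w i)]
  have hu : (fun _ : ℝ => w i • u i) =O[atTop] fun _ => (1 : ℝ) := isBigO_const_one _ _ _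
  simpa using (isBigO_exp_mul (hℓ i hi)).smul hu

theorem isBigO_inv_sum_exp_sub [DecidableEq ι] {i₀ : ι} {g : ℝ} (hg : 0 < g) (h₀ : i₀ ∈ P)
    (hw₀ : w i₀ ≠ 0) (hℓ₀ : ℓ i₀ = 0) (hℓ : ∀ i ∈ P.erase i₀, ℓ i ≤ -g) :
    (fun t : ℝ => (∑ i ∈ P, w i * Real.exp (t * ℓ i))⁻¹ - (w i₀)⁻¹) =O[atTop]
      fun t => Real.exp (-g * t) := by
  have hsub : (fun t : ℝ => ∑ i ∈ P, w i * Real.exp (t * ℓ i) - w i₀) =O[atTop]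
      fun t => Real.exp (-g * t) := by
    refine (isBigO_sum_exp_smul hℓ w fun _ => (1 : ℝ)).congr_left fun t => ?_
    simp [← Finset.add_sum_erase P _ h₀, hℓ₀]
  have hexp : Tendsto (fun t : ℝ => Real.exp (-g * t)) atTop (𝓝 0) :=
    Real.tendsto_exp_atBot.comp (tendsto_id.const_mul_atTop_of_neg (neg_lt_zero.2 hg))
  have htendsto := tendsto_sub_nhds_zero_iff.1 (hsub.trans_tendsto hexp)
  exact ((hasDerivAt_inv hw₀).isBigO_sub.comp_tendsto htendsto).trans hsub

theorem isBigO_expAverage_sub_of_eq_zero [DecidableEq ι] {i₀ i₁ : ι} {g γ : ℝ} (hg : 0 < g)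
    (hgγ : g ≤ γ) (hγ : γ ≤ 2 * g) (hw : ∀ i ∈ P, 0 < w i) (h₀ : i₀ ∈ P) (h₁ : i₁ ∈ P.erase i₀)
    (hℓ₀ : ℓ i₀ = 0) (hℓ₁ : ℓ i₁ = -g) (hℓ : ∀ i ∈ (P.erase i₀).erase i₁, ℓ i ≤ -γ) (v : ι → E) :
    (fun t : ℝ => expAverage P w ℓ v t -
      (v i₀ + (w i₁ / w i₀ * Real.exp (-g * t)) • (v i₁ - v i₀))) =O[atTop]
      fun t => Real.exp (-γ * t) := by
  let D : ℝ → ℝ := fun t => ∑ i ∈ P, w i * Real.exp (t * ℓ i)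
  let N : ℝ → E := fun t => ∑ i ∈ P, (w i * Real.exp (t * ℓ i)) • (v i - v i₀)
  let A : ℝ → E := fun t => Real.exp (-g * t) • w i₁ • (v i₁ - v i₀)
  have hN : (fun t => N t - A t) =O[atTop] fun t => Real.exp (-γ * t) := by
    refine (isBigO_sum_exp_smul hℓ w fun i => v i - v i₀).congr_left fun t => ?_
    simp [N, A, ← Finset.add_sum_erase P _ h₀, ← Finset.add_sum_erase _ _ h₁, hℓ₁, mul_smul,
      mul_comm t, smul_comm (w i₁)]
  have hDsub : (fun t => (D t)⁻¹ - (w i₀)⁻¹) =O[atTop] fun t => Real.exp (-g * t) := by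
    refine isBigO_inv_sum_exp_sub hg h₀ (hw i₀ h₀).ne' hℓ₀ fun i hi => ?_
    rcases eq_or_ne i i₁ with rfl | hi₁
    · exact hℓ₁.le
    · exact (hℓ i (Finset.mem_erase.2 ⟨hi₁, hi⟩)).trans (neg_le_neg hgγ)
  have hexp : (fun t : ℝ => Real.exp (-g * t)) =O[atTop] fun _ => (1 : ℝ) := by
    simpa [mul_comm] using isBigO_exp_mul (c := -g) (γ := 0) (by linarith)
  have hD : (fun t => (D t)⁻¹) =O[atTop] fun _ => (1 : ℝ) := by
    simpa using (hDsub.trans hexp).add (isBigO_const_one ℝ (w i₀)⁻¹ _)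
  have hA : A =O[atTop] fun t => Real.exp (-g * t) := by
    simpa [A] using (isBigO_refl (fun t : ℝ => Real.exp (-g * t)) atTop).smul
      (isBigO_const_one ℝ (w i₁ • (v i₁ - v i₀)) atTop)
  have hDA : (fun t => ((D t)⁻¹ - (w i₀)⁻¹) • A t) =O[atTop] fun t => Real.exp (-γ * t) := by
    refine (hDsub.smul hA).trans ((isBigO_exp_mul (c := -(2 * g)) (neg_le_neg hγ)).congr_left
      fun t => ?_)
    rw [smul_eq_mul, ← Real.exp_add]
    ring_nf
  have hDN : (fun t => (D t)⁻¹ • (N t - A t)) =O[atTop] fun t => Real.exp (-γ * t) := by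
    simpa using hD.smul hN
  refine (hDN.add hDA).congr_left fun t => ?_
  have hDt : D t ≠ 0 := (Finset.sum_pos (fun i hi => mul_pos (hw i hi) (Real.exp_pos _))
    ⟨i₀, h₀⟩).ne'
  have haverage : expAverage P w ℓ v t = v i₀ + (D t)⁻¹ • N t := by
    simp only [N, smul_sub, Finset.sum_sub_distrib, ← Finset.sum_smul]
    rw [inv_smul_smul₀ hDt, add_sub_cancel]
    rfl
  rw [haverage, div_eq_inv_mul]
  simp only [A, smul_sub, sub_smul, mul_smul, smul_comm (Real.exp _)]
  abel

theorem exists_isBigO_expAverage_sub {i₀ i₁ : ι} (hw : ∀ i ∈ P, 0 < w i)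
    (h₀ : i₀ ∈ P) (h₁ : i₁ ∈ P) (hlt : ℓ i₁ < ℓ i₀)
    (hrest : ∀ i ∈ P, i ≠ i₀ → i ≠ i₁ → ℓ i < ℓ i₁) (v : ι → E) :
    ∃ γ : ℝ, ℓ i₀ - ℓ i₁ < γ ∧
      (fun t : ℝ => expAverage P w ℓ v t -
        (v i₀ + (w i₁ / w i₀ * Real.exp (-(ℓ i₀ - ℓ i₁) * t)) • (v i₁ - v i₀))) =O[atTop]
        fun t : ℝ => Real.exp (-γ * t) := by
  classical
  have hg : 0 < ℓ i₀ - ℓ i₁ := sub_pos.2 hlt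
  have hdouble : ∀ᶠ γ in 𝓝[>] (ℓ i₀ - ℓ i₁), γ ≤ 2 * (ℓ i₀ - ℓ i₁) :=
    nhdsWithin_le_nhds (Iic_mem_nhds (by linarith))
  have hgap : ∀ᶠ γ in 𝓝[>] (ℓ i₀ - ℓ i₁), ∀ i ∈ (P.erase i₀).erase i₁, ℓ i - ℓ i₀ ≤ -γ := by
    rw [Filter.eventually_all_finset]
    intro i hi
    obtain ⟨hi₁, hi₀, hiP⟩ : i ≠ i₁ ∧ i ≠ i₀ ∧ i ∈ P := by simpa using hi
    have hlti := hrest i hiP hi₀ hi₁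
    have hlt' : ℓ i₀ - ℓ i₁ < ℓ i₀ - ℓ i := sub_lt_sub_left hlti _
    filter_upwards [nhdsWithin_le_nhds (Iic_mem_nhds hlt')] with γ hγ
    linarith [Set.mem_Iic.1 hγ]
  obtain ⟨γ, ⟨hγ, hℓ⟩, hlt'⟩ := ((hdouble.and hgap).and self_mem_nhdsWithin).exists
  refine ⟨γ, hlt', ?_⟩
  have hne : i₁ ∈ P.erase i₀ := Finset.mem_erase.2 ⟨fun h => hlt.ne (congrArg ℓ h), h₁⟩
  simpa only [expAverage_sub_const] using isBigO_expAverage_sub_of_eq_zero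
    (ℓ := fun i => ℓ i - ℓ i₀) hg (le_of_lt hlt') hγ hw h₀ hne (sub_self _) (neg_sub _ _).symm hℓ v

end ExpAverage

/-! ### The Verblunsky coefficients along the flow -/

section Coefficients

variable {n k : ℕ} {z : Fin n → ℂ}

theorem det_submatrix_castLE_mul_diagonal_mul_star (X : Matrix (Fin n) (Fin n) ℂ)
    (d : Fin n → ℂ) (hk : k ≤ n) :
    ((X * Matrix.diagonal d * star X).submatrix (Fin.castLE hk) (Fin.castLE hk)).det =
      ∑ e : Fin k ↪o Fin n, ‖(X.submatrix (Fin.castLE hk) e).det‖ ^ 2 •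
        multi d (Finset.univ.map e.toEmbedding) := by
  rw [Matrix.submatrix_mul _ _ _ id _ Function.bijective_id, det_mul_eq_sum_orderEmbedding]
  refine Finset.sum_congr rfl fun e _ => ?_
  have hleft : ((X * Matrix.diagonal d).submatrix (Fin.castLE hk) id).submatrix id e =
      Matrix.of fun i j => d (e j) * X.submatrix (Fin.castLE hk) e i j := by
    ext i j
    simp only [Matrix.submatrix_apply, id, Matrix.mul_diagonal, mul_comm, Matrix.of_apply]
  have hright : ((star X).submatrix id (Fin.castLE hk)).submatrix e id =
      (X.submatrix (Fin.castLE hk) e)ᴴ := rfl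
  rw [hleft, hright, Matrix.det_mul_row, Matrix.det_conjTranspose, mul_assoc, RCLike.star_def,
    Complex.mul_conj', mul_comm, Complex.real_smul, Complex.ofReal_pow, multi, Finset.prod_map]
  rfl

theorem det_submatrix_castLE_eq_centerMass {X : Matrix (Fin n) (Fin n) ℂ}
    (hX : X ∈ Matrix.unitaryGroup (Fin n) ℂ) (hk : k ≤ n) {κ : ℝ} {y : Finset (Fin n) → ℝ}
    (hy : ∀ e : Fin k ↪o Fin n, ‖(X.submatrix (Fin.castLE hk) e).det‖ ^ 2 =
      κ * y (Finset.univ.map e.toEmbedding)) (d : Fin n → ℂ) :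
    ((X * Matrix.diagonal d * star X).submatrix (Fin.castLE hk) (Fin.castLE hk)).det =
      (Finset.univ.powersetCard k).centerMass y (multi d) := by
  have hminor : ∀ d : Fin n → ℂ,
      ((X * Matrix.diagonal d * star X).submatrix (Fin.castLE hk) (Fin.castLE hk)).det =
        κ • ∑ I ∈ Finset.univ.powersetCard k, y I • multi d I := fun d => by
    rw [det_submatrix_castLE_mul_diagonal_mul_star]
    simp only [hy, mul_smul]
    rw [← Finset.smul_sum, sum_orderEmbedding fun I => y I • multi d I]
  have htotal : κ * ∑ I ∈ Finset.univ.powersetCard k, y I = 1 := by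
    have h := hminor fun _ => 1
    rw [Matrix.diagonal_one, mul_one, Matrix.mem_unitaryGroup_iff.1 hX,
      Matrix.submatrix_one _ (Fin.castLE_injective hk), Matrix.det_one] at h
    simp only [multi, Finset.prod_const_one, Complex.real_smul, mul_one] at h
    exact_mod_cast h.symm
  rw [hminor, Finset.centerMass, eq_inv_of_mul_eq_one_left htotal]

/-- The weight `|Δ_I|² μ_I` of a multi-index. -/
def weight (z : Fin n → ℂ) (μ : Fin n → ℝ) (I : Finset (Fin n)) : ℝ :=
  ‖vander z I‖ ^ 2 * multi μ I

/-- The multi-indices of size `a + 1`, over which the formula for the coefficient with (zero-based)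
index `a` averages. -/
def multiIndices (a : Fin n) : Finset (Finset (Fin n)) :=
  Finset.univ.powersetCard (a.val + 1)

theorem norm_exp_eulerPoly_sq (f : Polynomial ℂ) (t : ℝ) (w : ℂ) :
    ‖Complex.exp (t * (eulerPoly f).eval w)‖ ^ 2 = Real.exp (t * rate f w) := by
  rw [Complex.norm_exp, ← Real.exp_nat_mul, Complex.re_ofReal_mul, eulerPoly, Polynomial.eval_mul,
    Polynomial.eval_X, rate, Nat.cast_ofNat, mul_left_comm]

theorem exists_norm_minor_sq_eq [NeZero n] {α₀ : Fin n → ℂ} {W Q : Matrix (Fin n) (Fin n) ℂ}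
    (hα₀ : IsVerblunsky α₀) (hQ : Q ∈ Matrix.unitaryGroup (Fin n) ℂ)
    (hCQ : cmv α₀ * Q = Q * Matrix.diagonal z) (hW : W.IsLowerTriangular) (f : Polynomial ℂ)
    (t : ℝ) (hk : k ≤ n) :
    ∃ κ : ℝ, ∀ e : Fin k ↪o Fin n,
      ‖((W * (Q * expDiag (eulerPoly f) z t)).submatrix (Fin.castLE hk) e).det‖ ^ 2 =
        κ * (weight z (fun j => ‖Q 0 j‖ ^ 2) (Finset.univ.map e.toEmbedding) *
          Real.exp (t * ∑ i ∈ Finset.univ.map e.toEmbedding, rate f (z i))) := by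
  obtain ⟨c, hc, hcQ⟩ := exists_mul_norm_minor_eq hα₀ hQ hCQ hk
  refine ⟨‖(W.submatrix (Fin.castLE hk) (Fin.castLE hk)).det‖ ^ 2 / c ^ 2, fun e => ?_⟩
  have hQE : (Q * expDiag (eulerPoly f) z t).submatrix (Fin.castLE hk) e =
      Matrix.of fun i j => Complex.exp (t * (eulerPoly f).eval (z (e j))) *
        Q.submatrix (Fin.castLE hk) e i j := by
    ext i j
    rw [Matrix.submatrix_apply, expDiag, Matrix.mul_diagonal, mul_comm]
    rfl
  have hweight : weight z (fun j => ‖Q 0 j‖ ^ 2) (Finset.univ.map e.toEmbedding) =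
      c ^ 2 * ‖(Q.submatrix (Fin.castLE hk) e).det‖ ^ 2 := by
    rw [← mul_pow, hcQ, weight, vander_map_orderEmbedding, multi, Finset.prod_map, mul_pow,
      ← Finset.prod_pow, mul_comm]
    rfl
  have hexp : Real.exp (t * ∑ i ∈ Finset.univ.map e.toEmbedding, rate f (z i)) =
      ‖∏ j, Complex.exp (t * (eulerPoly f).eval (z (e j)))‖ ^ 2 := by
    rw [Finset.sum_map, Finset.mul_sum, Real.exp_sum, norm_prod, ← Finset.prod_pow]
    exact Finset.prod_congr rfl fun j _ => (norm_exp_eulerPoly_sq f t _).symm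
  rw [submatrix_castLE_mul_of_isLowerTriangular hk hW, hQE, Matrix.det_mul, Matrix.det_mul_row,
    hweight, hexp, norm_mul, norm_mul]
  field_simp

theorem verblunsky_eq_det_star_cmv {α : Fin n → ℂ} (hα : IsVerblunsky α) (a : Fin n) :
    α a = (-1) ^ a.val * ((star (cmv α)).submatrix (Fin.castLE a.isLt) (Fin.castLE a.isLt) :
      Matrix (Fin (a.val + 1)) (Fin (a.val + 1)) ℂ).det := by
  have hstar : ((star (cmv α)).submatrix (Fin.castLE a.isLt) (Fin.castLE a.isLt) :
      Matrix (Fin (a.val + 1)) (Fin (a.val + 1)) ℂ) =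
      ((cmv α).submatrix (Fin.castLE a.isLt) (Fin.castLE a.isLt))ᴴ := rfl
  rw [hstar, Matrix.det_conjTranspose, det_cmv_submatrix_castLE hα a a.isLt, star_mul', star_pow,
    star_neg, star_one, ← mul_assoc, ← mul_pow, neg_one_mul, neg_neg, one_pow, one_mul,
    RCLike.star_def, RCLike.conj_conj]

theorem intertwined_mul_eq_mul_diagonal {A B W Q : Matrix (Fin n) (Fin n) ℂ}
    (hAQ : A * Q = Q * Matrix.diagonal z) (hBW : B * W = W * A) (p : Polynomial ℂ) (t : ℝ) :
    B * (W * (Q * expDiag p z t)) = W * (Q * expDiag p z t) * Matrix.diagonal z := by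
  have hcomm : Matrix.diagonal z * expDiag p z t = expDiag p z t * Matrix.diagonal z :=
    Matrix.commute_diagonal z _
  rw [← mul_assoc, hBW, mul_assoc W A, ← mul_assoc A, hAQ, mul_assoc Q, hcomm]
  simp only [mul_assoc]

theorem star_eq_mul_diagonal_star_mul_star {B X : Matrix (Fin n) (Fin n) ℂ}
    (hX : X ∈ Matrix.unitaryGroup (Fin n) ℂ) (hBX : B * X = X * Matrix.diagonal z) :
    star B = X * Matrix.diagonal (star z) * star X := by
  rw [eq_mul_diagonal_mul_star hX hBX, star_mul, star_mul, star_star, ← mul_assoc,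
    Matrix.star_eq_conjTranspose (Matrix.diagonal z), Matrix.diagonal_conjTranspose]

variable {α : Fin n → ℂ}

theorem norm_eigenvalue_eq_one (hα : IsVerblunsky α)
    (hz : (cmv α).charpoly = ∏ j, (Polynomial.X - Polynomial.C (z j))) (j : Fin n) :
    ‖z j‖ = 1 := by
  have hC := cmv_mem_unitaryGroup hα
  obtain ⟨Q, hQ, hCQ⟩ := exists_unitary_mul_eq_mul_diagonal hC hz
  exact norm_eq_one_of_diagonal_mem_unitaryGroup (diagonal_mem_unitaryGroup_of_mul_eq hC hQ hCQ) j

variable [NeZero n]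

theorem eigenvalues_injective_of_charpoly_eq (hα : IsVerblunsky α)
    (hz : (cmv α).charpoly = ∏ j, (Polynomial.X - Polynomial.C (z j))) : Function.Injective z := by
  obtain ⟨Q, hQ, hCQ⟩ := exists_unitary_mul_eq_mul_diagonal (cmv_mem_unitaryGroup hα) hz
  exact eigenvalues_injective hα hQ hCQ

theorem spectralMass_pos (hα : IsVerblunsky α)
    (hz : (cmv α).charpoly = ∏ j, (Polynomial.X - Polynomial.C (z j))) (j : Fin n) :
    0 < spectralMass (cmv α) (z j) := by
  obtain ⟨Q, hQ, hCQ⟩ := exists_unitary_mul_eq_mul_diagonal (cmv_mem_unitaryGroup hα) hz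
  rw [spectralMass_eq hQ hCQ (eigenvalues_injective hα hQ hCQ)]
  exact pow_pos (norm_pos_iff.2 (eigenvector_zero_ne_zero hα hQ hCQ j)) 2

namespace IsTrajectory

variable {f : Polynomial ℂ} {C : ℝ → Matrix (Fin n) (Fin n) ℂ} {α₀ : Fin n → ℂ} {t : ℝ}

theorem exists_eq_cmv (hC : IsTrajectory (hamiltonian f) C) (hα₀ : IsVerblunsky α₀)
    (hC₀ : C 0 = cmv α₀) (hz : (C 0).charpoly = ∏ j, (Polynomial.X - Polynomial.C (z j)))
    (ht : 0 ≤ t) : ∃ α, IsVerblunsky α ∧ C t = cmv α := by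
  obtain ⟨Q, hQ, hCQ⟩ :=
    exists_unitary_mul_eq_mul_diagonal (hC₀ ▸ cmv_mem_unitaryGroup hα₀) hz
  have hintertwine := hC.mul_intertwiner ht
  have hCt := mem_unitaryGroup_of_mul_eq_mul_diagonal
    (hC.intertwiner_mul_mem_unitaryGroup hQ hCQ ht) (norm_eigenvalue_eq_one hα₀ (hC₀ ▸ hz))
    (intertwined_mul_eq_mul_diagonal hCQ hintertwine (eulerPoly f) t)
  exact exists_cmv_of_mul_posLower_eq hα₀ (isPosLower_intertwiner t) hCt (hC₀ ▸ hintertwine)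

theorem verblunsky_eq_expAverage (hC : IsTrajectory (hamiltonian f) C) (hα₀ : IsVerblunsky α₀)
    (hC₀ : C 0 = cmv α₀) (hz : (C 0).charpoly = ∏ j, (Polynomial.X - Polynomial.C (z j)))
    (ht : 0 ≤ t) (hα : IsVerblunsky α) (hCt : C t = cmv α) (a : Fin n) :
    α a = (-1) ^ a.val * expAverage (multiIndices a) (weight z fun j => spectralMass (C 0) (z j))
      (fun I => ∑ i ∈ I, rate f (z i)) (fun I => conj (multi z I)) t := by
  obtain ⟨Q, hQ, hCQ⟩ :=
    exists_unitary_mul_eq_mul_diagonal (hC₀ ▸ cmv_mem_unitaryGroup hα₀) hz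
  have hmass : (fun j => spectralMass (C 0) (z j)) = fun j => ‖Q 0 j‖ ^ 2 := funext fun j =>
    spectralMass_eq hQ hCQ (eigenvalues_injective_of_charpoly_eq hα₀ (hC₀ ▸ hz)) j
  have hX := hC.intertwiner_mul_mem_unitaryGroup hQ hCQ ht
  obtain ⟨κ, hκ⟩ := exists_norm_minor_sq_eq hα₀ hQ (hC₀ ▸ hCQ)
    (isPosLower_intertwiner (f := f) (C := C) t).isLowerTriangular f t a.isLt
  have hstar := star_eq_mul_diagonal_star_mul_star hX
    (intertwined_mul_eq_mul_diagonal hCQ (hC.mul_intertwiner ht) (eulerPoly f) t)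
  have hconj : multi (star z) = fun I => conj (multi z I) :=
    funext fun I => (map_prod (starRingEnd ℂ) z I).symm
  rw [verblunsky_eq_det_star_cmv hα, ← hCt, hstar, det_submatrix_castLE_eq_centerMass hX a.isLt
    (y := fun I => weight z (fun j => ‖Q 0 j‖ ^ 2) I * Real.exp (t * ∑ i ∈ I, rate f (z i))) hκ,
    hmass, hconj]
  rfl

end IsTrajectory

end Coefficients

/-! ### The leading multi-indices -/

section Exchange

variable {ι : Type*} [DecidableEq ι] {s t : Finset ι} {f : ι → ℝ} {c : ℝ}

theorem sum_sub_sum_of_card_eq (hcard : t.card = s.card) (f : ι → ℝ) (c : ℝ) :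
    ∑ i ∈ s, f i - ∑ i ∈ t, f i = ∑ i ∈ s \ t, (f i - c) + ∑ i ∈ t \ s, (c - f i) := by
  have h := Finset.sum_sdiff_sub_sum_sdiff (s₁ := t) (s₂ := s) (f := fun i => f i - c)
  simp only [Finset.sum_sub_distrib, Finset.sum_const, hcard] at h ⊢
  linarith

theorem sum_le_sum_of_card_eq (hcard : t.card = s.card) (hs : ∀ i ∈ s \ t, c ≤ f i)
    (ht : ∀ i ∈ t \ s, f i ≤ c) : ∑ i ∈ t, f i ≤ ∑ i ∈ s, f i := by
  rw [← sub_nonneg, sum_sub_sum_of_card_eq hcard f c]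
  exact add_nonneg (Finset.sum_nonneg fun i hi => sub_nonneg.2 (hs i hi))
    (Finset.sum_nonneg fun i hi => sub_nonneg.2 (ht i hi))

theorem sum_eq_sum_iff_of_card_eq (hcard : t.card = s.card) (hs : ∀ i ∈ s \ t, c ≤ f i)
    (ht : ∀ i ∈ t \ s, f i ≤ c) :
    ∑ i ∈ t, f i = ∑ i ∈ s, f i ↔ (∀ i ∈ s \ t, f i = c) ∧ ∀ i ∈ t \ s, f i = c := by
  have hs' : ∀ i ∈ s \ t, 0 ≤ f i - c := fun i hi => sub_nonneg.2 (hs i hi)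
  have ht' : ∀ i ∈ t \ s, 0 ≤ c - f i := fun i hi => sub_nonneg.2 (ht i hi)
  rw [eq_comm, ← sub_eq_zero, sum_sub_sum_of_card_eq hcard f c,
    add_eq_zero_iff_of_nonneg (Finset.sum_nonneg hs') (Finset.sum_nonneg ht'),
    Finset.sum_eq_zero_iff_of_nonneg hs', Finset.sum_eq_zero_iff_of_nonneg ht']
  simp only [sub_eq_zero, eq_comm]

end Exchange

section LeadingSets

variable {n : ℕ} {lam : Fin n → ℝ} {z : Fin n → ℂ} {μ : Fin n → ℝ} {a b : Fin n}
  {I : Finset (Fin n)}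

theorem mem_multiIndices : I ∈ multiIndices a ↔ I.card = a.val + 1 := by
  simp [multiIndices, Finset.mem_powersetCard]

theorem Iic_mem_multiIndices (a : Fin n) : Finset.Iic a ∈ multiIndices a :=
  mem_multiIndices.2 (Fin.card_Iic a)

theorem insert_Iio_mem_multiIndices (hab : a < b) :
    insert b (Finset.Iio a) ∈ multiIndices a := by
  rw [mem_multiIndices, Finset.card_insert_of_notMem (by simpa using hab.le), Fin.card_Iio]

theorem card_eq_card_Iic (hI : I ∈ multiIndices a) : I.card = (Finset.Iic a).card :=
  (mem_multiIndices.1 hI).trans (Fin.card_Iic a).symm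

theorem sum_le_sum_Iic (hanti : Antitone lam) (hI : I ∈ multiIndices a) :
    ∑ i ∈ I, lam i ≤ ∑ i ∈ Finset.Iic a, lam i :=
  sum_le_sum_of_card_eq (card_eq_card_Iic hI)
    (fun _ hi => hanti (Finset.mem_Iic.1 (Finset.mem_sdiff.1 hi).1))
    fun _ hi => hanti (le_of_not_ge fun h => (Finset.mem_sdiff.1 hi).2 (Finset.mem_Iic.2 h))

/-- The multi-indices of size `a + 1` with the largest exponent `∑_{i ∈ I} λ_i` (`λ` being
non-increasing). They are the ones that contribute to the limit of the averages. -/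
def leadingSets (lam : Fin n → ℝ) (a : Fin n) : Finset (Finset (Fin n)) :=
  {I ∈ multiIndices a | ∑ i ∈ I, lam i = ∑ i ∈ Finset.Iic a, lam i}

theorem Iic_mem_leadingSets (lam : Fin n → ℝ) (a : Fin n) : Finset.Iic a ∈ leadingSets lam a :=
  Finset.mem_filter.2 ⟨Iic_mem_multiIndices a, rfl⟩

theorem mem_leadingSets_iff (hanti : Antitone lam) :
    I ∈ leadingSets lam a ↔
      I.card = a.val + 1 ∧ above lam a ⊆ I ∧ ∀ i ∈ I, lam a ≤ lam i := by
  rw [leadingSets, Finset.mem_filter, ← mem_multiIndices]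
  refine and_congr_right fun hI => ?_
  have hle : ∀ i ∈ Finset.Iic a \ I, lam a ≤ lam i := fun i hi =>
    hanti (Finset.mem_Iic.1 (Finset.mem_sdiff.1 hi).1)
  have hge : ∀ i ∈ I \ Finset.Iic a, lam i ≤ lam a := fun i hi =>
    hanti (le_of_not_ge fun h => (Finset.mem_sdiff.1 hi).2 (Finset.mem_Iic.2 h))
  rw [sum_eq_sum_iff_of_card_eq (card_eq_card_Iic hI) hle hge]
  constructor
  · rintro ⟨hmissing, hextra⟩
    refine ⟨fun i hi => ?_, fun i hi => ?_⟩
    · have hlt : lam a < lam i := (Finset.mem_filter.1 hi).2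
      by_contra hiI
      exact hlt.ne' (hmissing i (Finset.mem_sdiff.2
        ⟨Finset.mem_Iic.2 (hanti.reflect_lt hlt).le, hiI⟩))
    · by_cases hia : i ≤ a
      · exact hanti hia
      · exact (hextra i (Finset.mem_sdiff.2 ⟨hi, by simpa using hia⟩)).ge
  · rintro ⟨habove, htied⟩
    refine ⟨fun i hi => le_antisymm (le_of_not_gt fun h => ?_) (hle i hi), fun i hi =>
      le_antisymm (hge i hi) (htied i (Finset.mem_sdiff.1 hi).1)⟩
    exact (Finset.mem_sdiff.1 hi).2 (habove (Finset.mem_filter.2 ⟨Finset.mem_univ i, h⟩))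

theorem above_subset_Iio (hanti : Antitone lam) (a : Fin n) : above lam a ⊆ Finset.Iio a :=
  fun _ hl => Finset.mem_Iio.2 (hanti.reflect_lt (Finset.mem_filter.1 hl).2)

theorem disjoint_above_of_mem_choices (hI : I ∈ choices lam a) : Disjoint (above lam a) I := by
  refine Finset.disjoint_left.2 fun l hl hlI => ?_
  exact (Finset.mem_filter.1 hl).2.ne'
    (Finset.mem_filter.1 ((Finset.mem_powersetCard.1 hI).1 hlI)).2

theorem sum_leadingSets (hanti : Antitone lam) {M : Type*} [AddCommMonoid M]
    (F : Finset (Fin n) → M) :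
    ∑ I ∈ leadingSets lam a, F I = ∑ I ∈ choices lam a, F (above lam a ∪ I) := by
  have habove : (above lam a).card ≤ a.val :=
    (Finset.card_le_card (above_subset_Iio hanti a)).trans_eq (Fin.card_Iio a)
  refine Finset.sum_nbij' (· \ above lam a) (above lam a ∪ ·) (fun I hI => ?_) (fun I hI => ?_)
    (fun I hI => ?_) (fun I hI => Finset.union_sdiff_cancel_left (disjoint_above_of_mem_choices hI))
    fun I hI => ?_
  · obtain ⟨hcard, hsub, htied⟩ := (mem_leadingSets_iff hanti).1 hI
    refine Finset.mem_powersetCard.2 ⟨fun i hi => ?_, by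
      rw [Finset.card_sdiff_of_subset hsub, hcard]⟩
    obtain ⟨hiI, hia⟩ := Finset.mem_sdiff.1 hi
    simp only [above, Finset.mem_filter_univ, not_lt] at hia
    exact Finset.mem_filter.2 ⟨Finset.mem_univ i, le_antisymm hia (htied i hiI)⟩
  · obtain ⟨hsub, hcard⟩ := Finset.mem_powersetCard.1 hI
    refine (mem_leadingSets_iff hanti).2 ⟨?_, Finset.subset_union_left, fun i hi => ?_⟩
    · rw [Finset.card_union_of_disjoint (disjoint_above_of_mem_choices hI), hcard]
      lia
    · rcases Finset.mem_union.1 hi with hi | hi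
      · exact (Finset.mem_filter.1 hi).2.le
      · exact (Finset.mem_filter.1 (hsub hi)).2.ge
  · exact Finset.union_sdiff_of_subset ((mem_leadingSets_iff hanti).1 hI).2.1
  · simp only [Finset.union_sdiff_of_subset ((mem_leadingSets_iff hanti).1 hI).2.1]

theorem insert_Iio_mem_leadingSets (hanti : Antitone lam) (hab : a < b) (htied : lam b = lam a) :
    insert b (Finset.Iio a) ∈ leadingSets lam a := by
  refine (mem_leadingSets_iff hanti).2 ⟨mem_multiIndices.1 (insert_Iio_mem_multiIndices hab),
    (above_subset_Iio hanti a).trans (Finset.subset_insert _ _), fun i hi => ?_⟩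
  rcases Finset.mem_insert.1 hi with rfl | hi
  · exact htied.ge
  · exact hanti (Finset.mem_Iio.1 hi).le

theorem leadingSets_eq_singleton (hanti : Antitone lam) (hab : b.val = a.val + 1)
    (hlt : lam b < lam a) : leadingSets lam a = {Finset.Iic a} := by
  refine Finset.eq_singleton_iff_unique_mem.2 ⟨Iic_mem_leadingSets lam a, fun I hI => ?_⟩
  obtain ⟨hcard, -, htied⟩ := (mem_leadingSets_iff hanti).1 hI
  refine Finset.eq_of_subset_of_card_le (fun i hi => ?_) ((Fin.card_Iic a).trans hcard.symm).le
  have hib : i < b := hanti.reflect_lt (hlt.trans_le (htied i hi))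
  exact Finset.mem_Iic.2 (by lia)

theorem sum_insert_erase_Iic {m : Fin n} (hm : m ≤ a) (hab : a < b) (lam : Fin n → ℝ) :
    ∑ i ∈ insert b ((Finset.Iic a).erase m), lam i =
      lam b + (∑ i ∈ Finset.Iic a, lam i - lam m) := by
  have hb : b ∉ (Finset.Iic a).erase m := by simp [hab]
  rw [Finset.sum_insert hb, Finset.sum_erase_eq_sub (Finset.mem_Iic.2 hm)]

theorem sum_lt_sum_insert_erase_Iic {m : Fin n} (hlam : StrictAnti lam) (hab : b.val = a.val + 1)
    (hI : I ∈ multiIndices a) (hm : m ≤ a) (hmI : m ∉ I)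
    (hne : I ≠ insert b ((Finset.Iic a).erase m)) :
    ∑ i ∈ I, lam i < ∑ i ∈ insert b ((Finset.Iic a).erase m), lam i := by
  set J := insert b ((Finset.Iic a).erase m) with hJ
  have hab' : a < b := Fin.lt_def.2 (by lia)
  have hcard : I.card = J.card := by
    rw [hJ, Finset.card_insert_of_notMem (by simp [hab']),
      Finset.card_erase_add_one (Finset.mem_Iic.2 hm), card_eq_card_Iic hI]
  have hge : ∀ i ∈ J \ I, lam b ≤ lam i := fun i hi => by
    rcases Finset.mem_insert.1 (Finset.mem_sdiff.1 hi).1 with rfl | hi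
    · exact le_rfl
    · have hia : i ≤ a := Finset.mem_Iic.1 (Finset.mem_of_mem_erase hi)
      exact hlam.antitone (by lia)
  have hgt : ∀ i ∈ I \ J, lam i < lam b := fun i hi => by
    obtain ⟨hiI, hiJ⟩ := Finset.mem_sdiff.1 hi
    have him : i ≠ m := fun h => hmI (h ▸ hiI)
    have hbi : i ≠ b ∧ a < i := by simpa [hJ, him] using hiJ
    exact hlam (by lia)
  refine (sum_le_sum_of_card_eq hcard hge fun i hi => (hgt i hi).le).lt_of_ne fun heq => hne ?_
  refine Finset.eq_of_subset_of_card_le (fun i hiI => ?_) hcard.ge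
  by_contra hiJ
  have hi := Finset.mem_sdiff.2 ⟨hiI, hiJ⟩
  exact (hgt i hi).ne
    (((sum_eq_sum_iff_of_card_eq hcard hge fun i hi => (hgt i hi).le).1 heq).2 i hi)

theorem sum_lt_sum_insert_Iio (hlam : StrictAnti lam) (hab : b.val = a.val + 1)
    (hI : I ∈ multiIndices a) (hne : I ≠ Finset.Iic a) (hne' : I ≠ insert b (Finset.Iio a)) :
    ∑ i ∈ I, lam i < ∑ i ∈ insert b (Finset.Iio a), lam i := by
  have hlt : a < b := Fin.lt_def.2 (by lia)
  obtain ⟨m, hm, hmI⟩ : ∃ m ∈ Finset.Iic a, m ∉ I := Finset.not_subset.1 fun hsub =>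
    hne (Finset.eq_of_subset_of_card_le hsub (card_eq_card_Iic hI).le).symm
  rw [Finset.mem_Iic] at hm
  rw [← Finset.Iic_erase] at hne' ⊢
  rcases hm.eq_or_lt with rfl | hma
  · exact sum_lt_sum_insert_erase_Iic hlam hab hI le_rfl hmI hne'
  · have hle : ∑ i ∈ I, lam i ≤ ∑ i ∈ insert b ((Finset.Iic a).erase m), lam i := by
      rcases eq_or_ne I (insert b ((Finset.Iic a).erase m)) with rfl | hIm
      · exact le_rfl
      · exact (sum_lt_sum_insert_erase_Iic hlam hab hI hm hmI hIm).le
    refine hle.trans_lt ?_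
    rw [sum_insert_erase_Iic hm hlt, sum_insert_erase_Iic le_rfl hlt]
    linarith [hlam hma]

end LeadingSets

/-! ### Asymptotics of the Verblunsky coefficients -/

section Asymptotics

variable {n : ℕ} {lam : Fin n → ℝ} {z : Fin n → ℂ} {μ : Fin n → ℝ} {a b : Fin n}

theorem multi_union {M : Type} [CommMonoid M] (x : Fin n → M) {I J : Finset (Fin n)}
    (h : Disjoint I J) : multi x (I ∪ J) = multi x I * multi x J :=
  Finset.prod_union h

theorem multi_insert {M : Type} [CommMonoid M] (x : Fin n → M) {I : Finset (Fin n)}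
    (h : b ∉ I) : multi x (insert b I) = x b * multi x I :=
  Finset.prod_insert h

theorem norm_multi (hz : ∀ j, ‖z j‖ = 1) (I : Finset (Fin n)) : ‖multi z I‖ = 1 := by
  rw [multi, norm_prod]
  exact Finset.prod_eq_one fun i _ => hz i

theorem vander_ne_zero (hz : Function.Injective z) (I : Finset (Fin n)) : vander z I ≠ 0 :=
  Finset.prod_ne_zero_iff.2 fun _ hp =>
    sub_ne_zero.2 (hz.ne (Finset.mem_filter.1 hp).2.ne')

theorem weight_pos (hz : Function.Injective z) (hμ : ∀ j, 0 < μ j) (I : Finset (Fin n)) :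
    0 < weight z μ I :=
  mul_pos (pow_pos (norm_pos_iff.2 (vander_ne_zero hz I)) 2) (Finset.prod_pos fun i _ => hμ i)

theorem limitValue_eq_centerMass (hμ : ∀ j, μ j ≠ 0) (hanti : Antitone lam) :
    limitValue lam z μ a = (-1) ^ a.val *
      (leadingSets lam a).centerMass (weight z μ) fun I => conj (multi z I) := by
  have hJ : ((multi μ (above lam a) : ℝ) : ℂ) ≠ 0 :=
    Complex.ofReal_ne_zero.2 (Finset.prod_ne_zero_iff.2 fun i _ => hμ i)
  have hweight : ∀ I ∈ choices lam a, weight z μ (above lam a ∪ I) =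
      multi μ (above lam a) * (‖vander z (above lam a ∪ I)‖ ^ 2 * multi μ I) := fun I hI => by
    rw [weight, multi_union μ (disjoint_above_of_mem_choices hI), mul_left_comm]
  have hterm : ∀ I ∈ choices lam a,
      weight z μ (above lam a ∪ I) • conj (multi z (above lam a ∪ I)) =
        ((multi μ (above lam a) : ℝ) : ℂ) * (conj (multi z (above lam a)) *
          (((‖vander z (above lam a ∪ I)‖ ^ 2 * multi μ I : ℝ) : ℂ) * conj (multi z I))) :=
    fun I hI => by
      rw [hweight I hI, multi_union z (disjoint_above_of_mem_choices hI), map_mul,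
        Complex.real_smul, Complex.ofReal_mul]
      ring
  rw [Finset.centerMass, sum_leadingSets hanti, sum_leadingSets hanti,
    Finset.sum_congr rfl hweight, Finset.sum_congr rfl hterm, ← Finset.mul_sum, ← Finset.mul_sum,
    ← Finset.mul_sum, Complex.real_smul, Complex.ofReal_inv, Complex.ofReal_mul, inv_mul_eq_div,
    mul_div_mul_left _ _ hJ, limitValue, mul_assoc, mul_div_assoc]

theorem tendsto_expAverage_limitValue (hz : Function.Injective z) (hμ : ∀ j, 0 < μ j)
    (hanti : Antitone lam) (a : Fin n) :
    Tendsto (fun t => (-1) ^ a.val * expAverage (multiIndices a) (weight z μ)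
      (fun I => ∑ i ∈ I, lam i) (fun I => conj (multi z I)) t) atTop
      (𝓝 (limitValue lam z μ a)) := by
  rw [limitValue_eq_centerMass (fun j => (hμ j).ne') hanti]
  exact (tendsto_expAverage (fun I _ => weight_pos hz hμ I) (fun I => sum_le_sum_Iic hanti)
    ⟨_, Iic_mem_multiIndices a, rfl⟩ _).const_mul _

theorem conj_multi_Iic_ne (hz : Function.Injective z) (hz₁ : ∀ j, ‖z j‖ = 1) (hab : a < b) :
    conj (multi z (Finset.Iic a)) ≠ conj (multi z (insert b (Finset.Iio a))) := by
  refine (starRingEnd ℂ).injective.ne ?_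
  rw [← Finset.Iio_insert, multi_insert z (by simp), multi_insert z (by simpa using hab.le)]
  refine fun h => hz.ne hab.ne (mul_right_cancel₀ ?_ h)
  exact norm_ne_zero_iff.1 (by rw [norm_multi hz₁]; exact one_ne_zero)

theorem norm_limitValue_eq_one_iff (hz : Function.Injective z) (hz₁ : ∀ j, ‖z j‖ = 1)
    (hμ : ∀ j, 0 < μ j) (hanti : Antitone lam) (hab : b.val = a.val + 1) :
    ‖limitValue lam z μ a‖ = 1 ↔ lam b < lam a := by
  have hlt : a < b := Fin.lt_def.2 (by lia)
  have hnorm : ∀ I, ‖conj (multi z I)‖ = 1 := fun I => by rw [RCLike.norm_conj, norm_multi hz₁]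
  rw [limitValue_eq_centerMass (fun j => (hμ j).ne') hanti, norm_mul, norm_pow, norm_neg, norm_one,
    one_pow, one_mul]
  refine ⟨fun h => (hanti hlt.le).lt_of_ne fun htied => h.not_lt ?_, fun h => ?_⟩
  · have hmem := centerMass_mem_ball_of_strictConvexSpace (t := leadingSets lam a)
      (w := weight z μ) (z := fun I => conj (multi z I)) (p := (0 : ℂ)) (r := 1)
      (fun I _ => (weight_pos hz hμ I).le) (Iic_mem_leadingSets lam a)
      (insert_Iio_mem_leadingSets hanti hlt htied) (conj_multi_Iic_ne hz hz₁ hlt)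
      (weight_pos hz hμ _).ne' (weight_pos hz hμ _).ne'
      fun I _ => mem_closedBall_zero_iff.2 (hnorm I).le
    exact mem_ball_zero_iff.1 hmem
  · rw [leadingSets_eq_singleton hanti hab h, Finset.centerMass_singleton _ _
      (weight_pos hz hμ _).ne', hnorm]

theorem vander_insert (z : Fin n → ℂ) {x : Fin n} {K : Finset (Fin n)} (hK : ∀ i ∈ K, i < x) :
    vander z (insert x K) = vander z K * ∏ i ∈ K, (z x - z i) := by
  have hx : x ∉ K := fun h => lt_irrefl _ (hK x h)
  simp only [vander, Finset.prod_filter, Finset.prod_product]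
  rw [Finset.prod_insert hx, Finset.prod_eq_one, one_mul, ← Finset.prod_mul_distrib]
  · refine Finset.prod_congr rfl fun i hi => ?_
    rw [Finset.prod_insert hx, if_pos (hK i hi), mul_comm]
  · intro j hj
    rcases Finset.mem_insert.1 hj with rfl | hj
    · simp only [lt_self_iff_false, if_false]
    · rw [if_neg (hK j hj).not_gt]

theorem weight_insert_Iio (z : Fin n → ℂ) (μ : Fin n → ℝ) {x : Fin n} (hx : a ≤ x) :
    weight z μ (insert x (Finset.Iio a)) =
      weight z μ (Finset.Iio a) * (μ x * ∏ l ∈ Finset.Iio a, ‖z x - z l‖ ^ 2) := by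
  rw [weight, weight, vander_insert z fun i hi => (Finset.mem_Iio.1 hi).trans_le hx, norm_mul,
    norm_prod, mul_pow, ← Finset.prod_pow, multi_insert μ (by simpa using hx)]
  ring

theorem weight_insert_Iio_div_weight_Iic (hz : Function.Injective z) (hμ : ∀ j, 0 < μ j)
    (hab : a ≤ b) :
    weight z μ (insert b (Finset.Iio a)) / weight z μ (Finset.Iic a) =
      μ b / μ a * ∏ l ∈ Finset.Iio a, ‖(z b - z l) / (z a - z l)‖ ^ 2 := by
  rw [← Finset.Iio_insert, weight_insert_Iio z μ le_rfl, weight_insert_Iio z μ hab,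
    mul_div_mul_left _ _ (weight_pos hz hμ _).ne', mul_div_mul_comm, ← Finset.prod_div_distrib]
  simp only [norm_div, div_pow]

theorem weight_div_smul_sub_eq_mul_xi (hz : Function.Injective z) (hz₁ : ∀ j, ‖z j‖ = 1)
    (hμ : ∀ j, 0 < μ j) (hab : a ≤ b) :
    (weight z μ (insert b (Finset.Iio a)) / weight z μ (Finset.Iic a)) •
        (conj (multi z (insert b (Finset.Iio a))) - conj (multi z (Finset.Iic a))) =
      conj (multi z (Finset.Iic a)) * xi z μ a b := by
  have hza : z a * conj (z a) = 1 := by rw [RCLike.mul_conj, hz₁, RCLike.ofReal_one, one_pow]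
  rw [weight_insert_Iio_div_weight_Iic hz hμ hab, ← Finset.Iio_insert,
    multi_insert z (by simpa using hab), multi_insert z (by simp), map_mul, map_mul,
    Complex.real_smul, xi, Complex.ofReal_mul]
  linear_combination (-(conj (multi z (Finset.Iio a)) * conj (z b) * ((μ b / μ a : ℝ) : ℂ) *
    ((∏ l ∈ Finset.Iio a, ‖(z b - z l) / (z a - z l)‖ ^ 2 : ℝ) : ℂ))) * hza

theorem exists_isBigO_expAverage_sub_xi (hz : Function.Injective z) (hz₁ : ∀ j, ‖z j‖ = 1)
    (hμ : ∀ j, 0 < μ j) (hlam : StrictAnti lam) (hab : b.val = a.val + 1) :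
    ∃ γ : ℝ, lam a - lam b < γ ∧
      (fun t : ℝ => (-1) ^ a.val * expAverage (multiIndices a) (weight z μ)
          (fun I => ∑ i ∈ I, lam i) (fun I => conj (multi z I)) t -
        (-1) ^ a.val * conj (multi z (Finset.Iic a)) *
          (1 + xi z μ a b * (Real.exp (-(lam a - lam b) * t) : ℂ))) =O[atTop]
        fun t : ℝ => Real.exp (-γ * t) := by
  have hlt : a < b := Fin.lt_def.2 (by lia)
  have hgap : ∑ i ∈ Finset.Iic a, lam i - ∑ i ∈ insert b (Finset.Iio a), lam i =
      lam a - lam b := by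
    rw [← Finset.Iic_erase, sum_insert_erase_Iic le_rfl hlt]
    ring
  obtain ⟨γ, hγ, hO⟩ := exists_isBigO_expAverage_sub (fun I _ => weight_pos hz hμ I)
    (Iic_mem_multiIndices a) (insert_Iio_mem_multiIndices hlt)
    (sub_pos.1 (hgap ▸ sub_pos.2 (hlam hlt))) (fun I => sum_lt_sum_insert_Iio hlam hab)
    fun I => conj (multi z I)
  simp only [hgap] at hγ hO
  refine ⟨γ, hγ, (hO.const_mul_left ((-1) ^ a.val)).congr_left fun t => ?_⟩
  rw [mul_comm (_ / _), mul_smul, weight_div_smul_sub_eq_mul_xi hz hz₁ hμ hlt.le,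
    Complex.real_smul]
  ring

end Asymptotics

end CMVFlow

end

theorem theoremT (n : ℕ) [NeZero n] (f : Polynomial ℂ)
    -- a trajectory of the flow of `Im tr f` that starts at a CMV matrix
    (C : ℝ → Matrix (Fin n) (Fin n) ℂ) (hC : IsTrajectory (hamiltonian f) C)
    (hC0 : ∃ α₀ : Fin n → ℂ, IsVerblunsky α₀ ∧ C 0 = cmv α₀)
    -- the eigenvalues of the initial matrix, listed in an order for which `λ` is non-increasing
    (z : Fin n → ℂ) (hz : (C 0).charpoly = ∏ j, (Polynomial.X - Polynomial.C (z j)))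
    (lam : Fin n → ℝ) (hlam : ∀ j, lam j = rate f (z j)) (hanti : Antitone lam)
    -- the masses of the initial spectral measure
    (μ : Fin n → ℝ) (hμ : ∀ j, μ j = spectralMass (C 0) (z j)) :
    -- `C t` stays a CMV matrix
    (∀ t : ℝ, 0 ≤ t → ∃ α : Fin n → ℂ, IsVerblunsky α ∧ C t = cmv α) ∧
    -- the asymptotics of its Verblunsky coefficients
    ∀ α : ℝ → Fin n → ℂ, (∀ t : ℝ, 0 ≤ t → IsVerblunsky (α t) ∧ C t = cmv (α t)) →
      -- `a` and `b` are the positions of `k` and `k + 1` when counting from `0`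
      ∀ a b : Fin n, b.val = a.val + 1 →
        Tendsto (fun t => α t a) atTop (𝓝 (limitValue lam z μ a)) ∧
        (Tendsto (fun t => ‖α t a‖) atTop (𝓝 1) ↔ lam b < lam a) ∧
        (Function.Injective lam →
          0 < lam a - lam b ∧
          ∃ γ : ℝ, lam a - lam b < γ ∧
            (fun t : ℝ => α t a - (-1) ^ a.val * conj (multi z (Finset.Iic a)) *
              (1 + xi z μ a b * (Real.exp (-(lam a - lam b) * t) : ℂ)))
            =O[atTop] fun t : ℝ => Real.exp (-γ * t)) := by
  obtain ⟨α₀, hα₀, hC0⟩ := hC0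
  obtain rfl : lam = fun j => rate f (z j) := funext hlam
  obtain rfl : μ = fun j => spectralMass (C 0) (z j) := funext hμ
  have hz0 : (cmv α₀).charpoly = ∏ j, (Polynomial.X - Polynomial.C (z j)) := hC0 ▸ hz
  have hinj := eigenvalues_injective_of_charpoly_eq hα₀ hz0
  have hnorm := norm_eigenvalue_eq_one hα₀ hz0
  have hpos : ∀ j, 0 < spectralMass (C 0) (z j) := hC0 ▸ spectralMass_pos hα₀ hz0
  refine ⟨fun t ht => hC.exists_eq_cmv hα₀ hC0 hz ht, fun α hα a b hab => ?_⟩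
  have haverage : (fun t => (-1) ^ a.val * expAverage (multiIndices a)
      (weight z fun j => spectralMass (C 0) (z j)) (fun I => ∑ i ∈ I, rate f (z i))
      (fun I => conj (multi z I)) t) =ᶠ[atTop] fun t => α t a :=
    (eventually_ge_atTop 0).mono fun t ht =>
      (hC.verblunsky_eq_expAverage hα₀ hC0 hz ht (hα t ht).1 (hα t ht).2 a).symm
  have hlim := (tendsto_expAverage_limitValue hinj hpos hanti a).congr' haverage
  refine ⟨hlim, ?_, fun hlam_inj => ?_⟩
  · rw [← norm_limitValue_eq_one_iff hinj hnorm hpos hanti hab]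
    exact ⟨fun h => tendsto_nhds_unique hlim.norm h, fun h => h ▸ hlim.norm⟩
  · have hstrict := hanti.strictAnti_of_injective hlam_inj
    obtain ⟨γ, hγ, hO⟩ := exists_isBigO_expAverage_sub_xi hinj hnorm hpos hstrict hab
    have hab' : a < b := Fin.lt_def.2 (by lia)
    exact ⟨sub_pos.2 (hstrict hab'), γ, hγ, hO.congr' (haverage.sub .rfl) .rfl⟩
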